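/- Let $X$ be a connected $2$-dimensional CW-complex whose fundamental group $\pi_1(X)$ is free. Then $\operatorname{cat} X \le 1$. Here $\operatorname{cat} X$ is the Lusternik--Schnirelmann category, normalized so that a point has category $0$: the least integer $n \ge 0$ such that $X$ can be covered by $n+1$ open subsets $U_0, \dots, U_n$, each contractible in $X$ (that is, each inclusion $U_i \hookrightarrow X$ is homotopic to a constant map), and $\infty$ if there is no such $n$. -/

import Mathlib

/-- A subset `U` of a space `X` is contractible in `X` if its inclusion into `X` is homotopic to
a constant map. -/
def ContractibleIn {X : Type*} [TopologicalSpace X] (U : Set X) : Prop :=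
  ContinuousMap.Nullhomotopic (⟨Subtype.val, continuous_subtype_val⟩ : C(U, X))

/-- `X` is covered by `n + 1` open subsets, each of which is contractible in `X`. -/
def HasCategoricalCover (X : Type*) [TopologicalSpace X] (n : ℕ) : Prop :=
  ∃ U : Fin (n + 1) → Set X,
    (∀ i, IsOpen (U i)) ∧ (∀ i, ContractibleIn (U i)) ∧ ⋃ i, U i = Set.univ

/-- The Lusternik-Schnirelmann category of `X`, normalized so that a point has category `0`: the
least `n` such that `X` is covered by `n + 1` open subsets contractible in `X`, and `⊤` if there is
no such `n`. -/
noncomputable def lsCat (X : Type*) [TopologicalSpace X] : ℕ∞ :=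
  sInf {k : ℕ∞ | ∃ n : ℕ, k = n ∧ HasCategoricalCover X n}

/-- The dimension of a CW complex: the supremum of the dimensions of its cells. -/
noncomputable def cwDim {X : Type*} [TopologicalSpace X] (C : Set X) [Topology.CWComplex C] : ℕ∞ :=
  ⨆ (n : ℕ) (_ : Nonempty (Topology.RelCWComplex.cell C n)), (n : ℕ∞)

/-! A free group is the fundamental group of a graph, and a connected graph is covered by two open
sets contractible in it; the point is to pull such a cover back to `X`. Loops representing a free
basis define a map `e : Y → X`, bijective on fundamental groups, where `Y` is the suspension of a
discrete set (`exists_map_bijective_on_loops`). The complements `W₀`, `W₁` of the poles of `Y` are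
contractible in `Y`.

Surjectivity of `e` on loops lifts the inclusion of the 1-skeleton to `Y` up to homotopy
(`exists_lift_oneSkeleton`); injectivity extends the lift over the 2-cells to `g : X → Y`
(`exists_extension_twoSkeleton`). In general `e ∘ g` is not homotopic to the identity, since `π₂(X)`
may be nonzero. It is so away from the centres of the 2-cells, because that complement deforms
radially into the 1-skeleton (`exists_radial_deformation`). Hence `g ⁻¹' W₀` and `g ⁻¹' W₁`, with
the centres removed, are contractible in `X`.

The centres are recovered without a third set. The open discs of radius `1/2` are contractible in
`X` (`homotopicOn_const_of_disjoint_skeletonLT`) and disjoint from the part of `g ⁻¹' W₁` of radius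
greater than `1/2`, so the union of the two is still contractible in `X`. The circles of radius
`1/2` between them lie in `g ⁻¹' W₀`, as `g` is arranged to be constant with value in `W₀` on the
half-discs.

Homotopies on a subset are kept as total functions into a path space, continuous on that subset
only, so that they can be glued cell by cell. Note that `skeletonLT n` has cells of dimension below
`n`: the 1-skeleton is `skeletonLT 2`. -/

open Topology unitInterval CategoryTheory

universe u

/-! ### Homotopies over a subset -/

/-- The maps `f` and `g` are homotopic on the set `U`. -/
def HomotopicOn {X Z : Type*} [TopologicalSpace X] [TopologicalSpace Z] (U : Set X)
    (f g : X → Z) : Prop :=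
  ∃ K : X → C(I, Z), ContinuousOn K U ∧ ∀ x ∈ U, K x 0 = f x ∧ K x 1 = g x

/-- A family of paths that is jointly continuous over `S` is a map into the path space that is
continuous on `S`. -/
theorem exists_curry_continuousOn {A Z : Type*} [TopologicalSpace A] [TopologicalSpace Z]
    {S : Set A} {G : A → I → Z} (hG : ContinuousOn (Function.uncurry G) (S ×ˢ Set.univ)) :
    ∃ K : A → C(I, Z), ContinuousOn K S ∧ ∀ a ∈ S, ∀ t, K a t = G a t := by
  classical
  by_cases hA : S.Nonempty
  swap
  · rw [Set.not_nonempty_iff_eq_empty] at hA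
    subst hA
    by_cases hA : Nonempty A
    · obtain ⟨a⟩ := hA
      exact ⟨fun _ => ContinuousMap.const _ (G a 0), by simp, by simp⟩
    · exact ⟨fun a => (hA ⟨a⟩).elim, by simp, by simp⟩
  obtain ⟨a₀, ha₀⟩ := hA
  let H : C(S × I, Z) := ⟨fun p => G p.1 p.2,
    hG.comp_continuous (f := fun p : S × I => ((p.1 : A), p.2)) (by fun_prop)
      (fun p => ⟨p.1.2, trivial⟩)⟩
  refine ⟨fun a => if h : a ∈ S then H.curry ⟨a, h⟩ else H.curry ⟨a₀, ha₀⟩, ?_, ?_⟩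
  · rw [continuousOn_iff_continuous_domRestrict]
    convert H.curry.continuous using 1
    ext a t
    simp [Set.domRestrict]
  · intro a ha t
    simp only [dif_pos ha]
    rfl

namespace HomotopicOn

variable {X Y Z : Type*} [TopologicalSpace X] [TopologicalSpace Y] [TopologicalSpace Z]
  {U V : Set X} {f g h : X → Z}

theorem continuousOn_left (H : HomotopicOn U f g) : ContinuousOn f U := by
  obtain ⟨K, hK, h⟩ := H
  exact ((continuous_eval_const (0 : I)).comp_continuousOn hK).congr
    fun x hx => (h x hx).1.symm

theorem continuousOn_right (H : HomotopicOn U f g) : ContinuousOn g U := by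
  obtain ⟨K, hK, h⟩ := H
  exact ((continuous_eval_const (1 : I)).comp_continuousOn hK).congr
    fun x hx => (h x hx).2.symm

theorem homotopic (H : HomotopicOn U f g) :
    ContinuousMap.Homotopic (⟨U.domRestrict f, H.continuousOn_left.domRestrict⟩ : C(U, Z))
      ⟨U.domRestrict g, H.continuousOn_right.domRestrict⟩ := by
  obtain ⟨K, hK, h⟩ := id H
  let K' : C(U, C(I, Z)) := ⟨U.domRestrict K, hK.domRestrict⟩
  exact ⟨⟨K'.uncurry.comp .prodSwap, fun x => (h x x.2).1, fun x => (h x x.2).2⟩⟩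

theorem of_homotopic {f' g' : C(U, Z)} (H : f'.Homotopic g') (hf : ∀ x : U, f' x = f x)
    (hg : ∀ x : U, g' x = g x) : HomotopicOn U f g := by
  classical
  obtain ⟨H⟩ := H
  let K : C(U, C(I, Z)) := (H.toContinuousMap.comp .prodSwap).curry
  refine ⟨fun x => if h : x ∈ U then K ⟨x, h⟩ else ContinuousMap.const _ (f x), ?_, ?_⟩
  · rw [continuousOn_iff_continuous_domRestrict]
    convert K.continuous using 1
    ext a t
    simp [Set.domRestrict]
  · intro x hx
    simp [hx, K, ← hf ⟨x, hx⟩, ← hg ⟨x, hx⟩]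

theorem symm (H : HomotopicOn U f g) : HomotopicOn U g f :=
  of_homotopic H.homotopic.symm (fun _ => rfl) (fun _ => rfl)

theorem trans (H : HomotopicOn U f g) (H' : HomotopicOn U g h) : HomotopicOn U f h :=
  of_homotopic (H.homotopic.trans H'.homotopic) (fun _ => rfl) (fun _ => rfl)

theorem mono (H : HomotopicOn U f g) (hV : V ⊆ U) : HomotopicOn V f g := by
  obtain ⟨K, hK, h⟩ := H
  exact ⟨K, hK.mono hV, fun x hx => h x (hV hx)⟩

theorem congr {f' g' : X → Z} (H : HomotopicOn U f g) (hf : Set.EqOn f' f U)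
    (hg : Set.EqOn g' g U) : HomotopicOn U f' g' := by
  obtain ⟨K, hK, h⟩ := H
  exact ⟨K, hK, fun x hx => ⟨(h x hx).1.trans (hf hx).symm, (h x hx).2.trans (hg hx).symm⟩⟩

theorem comp_left (H : HomotopicOn U f g) (e : C(Z, Y)) :
    HomotopicOn U (e ∘ f) (e ∘ g) := by
  obtain ⟨K, hK, h⟩ := H
  exact ⟨fun x => e.comp (K x), (ContinuousMap.continuous_postcomp e).comp_continuousOn hK,
    fun x hx => by simp [h x hx]⟩

theorem comp_right (H : HomotopicOn U f g) {V : Set Y} {k : Y → X} (hk : ContinuousOn k V)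
    (hV : Set.MapsTo k V U) : HomotopicOn V (f ∘ k) (g ∘ k) := by
  obtain ⟨K, hK, h⟩ := H
  exact ⟨K ∘ k, hK.comp hk hV, fun x hx => h _ (hV hx)⟩

theorem union_of_disjoint (H : HomotopicOn U f g) (H' : HomotopicOn V f g) (hU : IsOpen U)
    (hV : IsOpen V) (hUV : Disjoint U V) : HomotopicOn (U ∪ V) f g := by
  classical
  obtain ⟨K, hK, h⟩ := H
  obtain ⟨L, hL, h'⟩ := H'
  have hVU : ∀ x ∈ V, x ∉ U := fun x hx hx' => Set.disjoint_left.1 hUV hx' hx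
  refine ⟨fun x => if x ∈ U then K x else L x, ContinuousOn.union_of_isOpen
    (hK.congr fun x hx => by simp [hx]) (hL.congr fun x hx => by simp [hVU x hx]) hU hV, ?_⟩
  rintro x (hx | hx)
  · simp [hx, h x hx]
  · simp [hVU x hx, h' x hx]

theorem contractibleIn {U : Set X} {x₀ : X} (H : HomotopicOn U id fun _ => x₀) :
    ContractibleIn U :=
  ⟨x₀, H.homotopic⟩

end HomotopicOn

/-! ### Filling a square with given boundary -/

/-- The map of the square to itself carrying horizontal lines to antidiagonals, with the vertical
sides collapsed to the corners `(0, 0)` and `(1, 1)`. -/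
def antidiagonalMap (p : ℝ × ℝ) : ℝ × ℝ :=
  (max (2 * p.2 - 1) 0 + (1 - p.1) * (min (2 * p.2) 1 - max (2 * p.2 - 1) 0),
    max (2 * p.2 - 1) 0 + p.1 * (min (2 * p.2) 1 - max (2 * p.2 - 1) 0))

theorem continuous_antidiagonalMap : Continuous antidiagonalMap := by
  unfold antidiagonalMap; fun_prop

theorem width_nonneg {s : ℝ} (h0 : 0 ≤ s) (h1 : s ≤ 1) :
    0 ≤ min (2 * s) 1 - max (2 * s - 1) 0 := by
  rcases le_total (2 * s) 1 with h | h
  · rw [min_eq_left h, max_eq_right (by linarith)]; linarith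
  · rw [min_eq_right h, max_eq_left (by linarith)]; linarith

theorem eq_zero_or_one_of_width_eq_zero {s : ℝ}
    (h : min (2 * s) 1 - max (2 * s - 1) 0 = 0) : s = 0 ∨ s = 1 := by
  rcases le_total (2 * s) 1 with h' | h'
  · rw [min_eq_left h', max_eq_right (by linarith)] at h; left; linarith
  · rw [min_eq_right h', max_eq_left (by linarith)] at h; right; linarith

theorem antidiagonalMap_add (p : ℝ × ℝ) :
    (antidiagonalMap p).1 + (antidiagonalMap p).2 = 2 * p.2 := by
  simp only [antidiagonalMap]
  rcases le_total (2 * p.2) 1 with h' | h'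
  · rw [min_eq_left h', max_eq_right (by linarith)]; ring
  · rw [min_eq_right h', max_eq_left (by linarith)]; ring

theorem antidiagonalMap_mem (p : I × I) :
    (antidiagonalMap (p.1, p.2)).1 ∈ I ∧ (antidiagonalMap (p.1, p.2)).2 ∈ I := by
  obtain ⟨⟨t, ht0, ht1⟩, ⟨s, hs0, hs1⟩⟩ := p
  have hw := width_nonneg hs0 hs1
  have hm : min (2 * s) 1 ≤ 1 := min_le_right _ _
  have hM : 0 ≤ max (2 * s - 1) 0 := le_max_right _ _
  simp only [antidiagonalMap, Set.mem_Icc]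
  refine ⟨⟨?_, ?_⟩, ?_, ?_⟩ <;> nlinarith

/-- A square with prescribed boundary can be filled if the boundary commutes up to homotopy. -/
theorem exists_square_of_homotopic {X : Type*} [TopologicalSpace X] {a b c d : X}
    {p : Path a b} {β : Path b d} {α : Path a c} {q : Path c d}
    (h : (p.trans β).Homotopic (α.trans q)) :
    ∃ K : C(I × I, X), (∀ s, K (s, 0) = p s) ∧ (∀ s, K (s, 1) = q s) ∧ (∀ t, K (0, t) = α t) ∧
      ∀ t, K (1, t) = β t := by
  obtain ⟨F⟩ := h
  let Q : C(I × I, I × I) :=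
    ⟨fun p => (⟨_, (antidiagonalMap_mem p).1⟩, ⟨_, (antidiagonalMap_mem p).2⟩), by
      have := continuous_antidiagonalMap
      refine Continuous.prodMk ?_ ?_ <;> refine Continuous.subtype_mk ?_ _ <;> fun_prop⟩
  have hsurj : Function.Surjective Q := by
    rintro ⟨⟨u, hu0, hu1⟩, ⟨v, hv0, hv1⟩⟩
    have hs0 : 0 ≤ (u + v) / 2 := by linarith
    have hs1 : (u + v) / 2 ≤ 1 := by linarith
    have hw := width_nonneg hs0 hs1
    set w := min (2 * ((u + v) / 2)) 1 - max (2 * ((u + v) / 2) - 1) 0 with hwdef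
    have hMv : max (2 * ((u + v) / 2) - 1) 0 ≤ v := max_le (by linarith) hv0
    have hMu : max (2 * ((u + v) / 2) - 1) 0 ≤ u := max_le (by linarith) hu0
    have hsum : w + 2 * max (2 * ((u + v) / 2) - 1) 0 = u + v := by
      rw [hwdef]
      rcases le_total (2 * ((u + v) / 2)) 1 with h' | h'
      · rw [min_eq_left h', max_eq_right (by linarith)]; ring
      · rw [min_eq_right h', max_eq_left (by linarith)]; ring
    have hvw : v - max (2 * ((u + v) / 2) - 1) 0 ≤ w := by linarith
    have key : (v - max (2 * ((u + v) / 2) - 1) 0) / w * w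
        = v - max (2 * ((u + v) / 2) - 1) 0 := by
      rcases hw.eq_or_lt with h' | h'
      -- At a corner the antidiagonal has width `0`; the quotient is then `0` by convention, and `v`
      -- equals the offset.
      · rw [← h']; rw [← h'] at hvw; simp; linarith
      · field_simp
    refine ⟨(⟨(v - max (2 * ((u + v) / 2) - 1) 0) / w, div_nonneg (by linarith) hw,
      div_le_one_of_le₀ hvw hw⟩, ⟨(u + v) / 2, hs0, hs1⟩), ?_⟩
    ext
    · simp only [Q, ContinuousMap.coe_mk, antidiagonalMap, ← hwdef]
      linarith
    · simp only [Q, ContinuousMap.coe_mk, antidiagonalMap, ← hwdef]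
      linarith
  have hQ : IsQuotientMap Q := Q.continuous.isClosedMap.isQuotientMap Q.continuous hsurj
  -- `Q` identifies points only within the sides `s = 0` and `s = 1`, where `F` is constant because
  -- it is a homotopy relative to the end points.
  have hfib : ∀ x y : I × I, Q x = Q y → F x = F y := by
    rintro ⟨t, s⟩ ⟨t', s'⟩ h
    have h1 : (antidiagonalMap (t, s)).1 = (antidiagonalMap (t', s')).1 :=
      congr_arg (fun z : I × I => (z.1 : ℝ)) h
    have h2 : (antidiagonalMap (t, s)).2 = (antidiagonalMap (t', s')).2 :=
      congr_arg (fun z : I × I => (z.2 : ℝ)) h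
    have hs : s = s' := by
      ext
      have e1 := antidiagonalMap_add (t, s)
      have e2 := antidiagonalMap_add (t', s')
      simp only at e1 e2
      linarith
    subst hs
    simp only [antidiagonalMap] at h2
    have : ((t : ℝ) - t') * (min (2 * (s : ℝ)) 1 - max (2 * (s : ℝ) - 1) 0) = 0 := by linarith
    rcases mul_eq_zero.1 this with h | h
    · rw [show t = t' from Subtype.ext (by linarith)]
    · rcases eq_zero_or_one_of_width_eq_zero h with h | h
      · rw [show s = 0 from Subtype.ext h]; simp
      · rw [show s = 1 from Subtype.ext h]; simp
  let K : C(I × I, X) := hQ.lift F.toContinuousMap hfib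
  have hK : ∀ x, K (Q x) = F x := fun x =>
    DFunLike.congr_fun (hQ.lift_comp F.toContinuousMap hfib) x
  have hI : ∀ s : I, (s : ℝ) / 2 ∈ I := fun s => ⟨by linarith [s.2.1], by linarith [s.2.2]⟩
  have hI' : ∀ s : I, (1 + (s : ℝ)) / 2 ∈ I := fun s => ⟨by linarith [s.2.1], by linarith [s.2.2]⟩
  refine ⟨K, fun s => ?_, fun s => ?_, fun t => ?_, fun t => ?_⟩
  · have : ((s, 0) : I × I) = Q (0, ⟨_, hI s⟩) := by
      ext <;> simp [Q, antidiagonalMap, mul_div_cancel₀, s.2.2]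
    rw [this, hK]
    simp only [ContinuousMap.HomotopyWith.apply_zero, Path.coe_toContinuousMap, Path.trans_apply]
    rw [dif_pos (by simpa using by linarith [s.2.2])]
    congr 1; ext; simp; ring
  · have : ((s, 1) : I × I) = Q (1, ⟨_, hI' s⟩) := by
      ext <;> simp [Q, antidiagonalMap, mul_div_cancel₀, s.2.1]
    rw [this, hK]
    simp only [ContinuousMap.HomotopyWith.apply_one, Path.coe_toContinuousMap, Path.trans_apply]
    split_ifs with h
    · have : s = 0 := Subtype.ext (le_antisymm (by simp at h ⊢; linarith) s.2.1)
      subst this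
      simp
    · congr 1; ext; simp; ring
  · have : ((0, t) : I × I) = Q (1, ⟨_, hI t⟩) := by
      ext <;> simp [Q, antidiagonalMap, mul_div_cancel₀, t.2.2]
    rw [this, hK]
    simp only [ContinuousMap.HomotopyWith.apply_one, Path.coe_toContinuousMap, Path.trans_apply]
    rw [dif_pos (by simpa using by linarith [t.2.2])]
    congr 1; ext; simp; ring
  · have : ((1, t) : I × I) = Q (0, ⟨_, hI' t⟩) := by
      ext <;> simp [Q, antidiagonalMap, mul_div_cancel₀, t.2.1]
    rw [this, hK]
    simp only [ContinuousMap.HomotopyWith.apply_zero, Path.coe_toContinuousMap, Path.trans_apply]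
    split_ifs with h
    · have : t = 0 := Subtype.ext (le_antisymm (by simp at h ⊢; linarith) t.2.1)
      subst this
      simp
    · congr 1; ext; simp; ring

/-! ### Path classes and the generation half of van Kampen -/

section PathClass

variable {X Y : Type*} [TopologicalSpace X] [TopologicalSpace Y] {a b c : X}

/-- The homotopy class of a path, as a morphism of the fundamental groupoid. -/
def pathClass (p : Path a b) : FundamentalGroupoid.mk a ⟶ FundamentalGroupoid.mk b :=
  Path.Homotopic.Quotient.mk p

theorem pathClass_eq_iff {p q : Path a b} : pathClass p = pathClass q ↔ p.Homotopic q :=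
  Path.Homotopic.Quotient.eq

theorem pathClass_trans (p : Path a b) (q : Path b c) :
    pathClass (p.trans q) = pathClass p ≫ pathClass q := rfl

theorem pathClass_symm (p : Path a b) : pathClass p.symm = inv (pathClass p) := by
  rw [← Groupoid.inv_eq_inv]; rfl

theorem pathClass_refl (a : X) : pathClass (Path.refl a) = 𝟙 _ := rfl

theorem pathClass_surjective (m : FundamentalGroupoid.mk a ⟶ FundamentalGroupoid.mk b) :
    ∃ p : Path a b, pathClass p = m :=
  Path.Homotopic.Quotient.mk_surjective m

/-- Surjectivity half of the Seifert--van Kampen theorem: if every piece of an open cover carries a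
coherent choice of path classes to the base point, then a loop is a product of transition
classes. -/
theorem pathClass_mem_of_open_cover {ι : Type*} {x₀ : X} {W : ι → Set X}
    (hW : ∀ i, IsOpen (W i)) (hcov : ⋃ i, W i = Set.univ)
    (k : ∀ i, ∀ x ∈ W i, FundamentalGroupoid.mk x ⟶ FundamentalGroupoid.mk x₀)
    (hk : ∀ i (x y : X) (hx : x ∈ W i) (hy : y ∈ W i) (p : Path x y), (∀ t, p t ∈ W i) →
      pathClass p ≫ k i y hy = k i x hx)
    (H : Subgroup (FundamentalGroup X x₀))
    (hH : ∀ i j x (hi : x ∈ W i) (hj : x ∈ W j), inv (k i x hi) ≫ k j x hj ∈ H)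
    (p : Path a b) (i j : ι) (ha : a ∈ W i) (hb : b ∈ W j) :
    inv (k i a ha) ≫ pathClass p ≫ k j b hb ∈ H := by
  obtain ⟨t, t_0, t_mono, ⟨n_max, h_max⟩, t_sub⟩ :=
    exists_monotone_Icc_subset_open_cover_unitInterval
      (c := fun i => p ⁻¹' W i) (fun i => (hW i).preimage p.continuous)
      (fun s _ => by
        have : p s ∈ ⋃ i, W i := hcov ▸ Set.mem_univ _
        simpa using this)
  -- The index `j` is arbitrary, so the induction can enter the next subinterval through the piece
  -- `e` containing it.
  have claim : ∀ n, ∀ i j (hi : p 0 ∈ W i) (hj : p (t n) ∈ W j),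
      inv (k i _ hi) ≫ pathClass (p.subpath 0 (t n)) ≫ k j _ hj ∈ H := by
    intro n
    induction n with
    | zero =>
      rw [t_0]
      intro i j hi hj
      rw [Path.subpath_self, pathClass_refl, Category.id_comp]
      exact hH _ _ _ _ _
    | succ n ih =>
      intro i j hi hj
      obtain ⟨e, he⟩ := t_sub n
      have he0 : p (t n) ∈ W e := he ⟨le_rfl, t_mono n.le_succ⟩
      have he1 : p (t (n + 1)) ∈ W e := he ⟨t_mono n.le_succ, le_rfl⟩
      have h1 : pathClass (p.subpath 0 (t (n + 1))) =
          pathClass (p.subpath 0 (t n)) ≫ pathClass (p.subpath (t n) (t (n + 1))) := by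
        rw [← pathClass_trans, pathClass_eq_iff]
        exact ⟨(Path.Homotopy.subpathTransSubpath p _ _ _).symm⟩
      have h2 := hk e _ _ he0 he1 (p.subpath (t n) (t (n + 1))) (fun s => by
        have : (p.subpath (t n) (t (n + 1))) s ∈ Set.range (p.subpath (t n) (t (n + 1))) := ⟨s, rfl⟩
        rw [Path.range_subpath_of_le _ _ _ (t_mono n.le_succ)] at this
        obtain ⟨s', hs', h⟩ := this
        rw [← h]
        exact he hs')
      -- The product in `End` is composition in reverse order, so the later factor is written first.
      have h3 := H.mul_mem (hH e j _ he1 hj) (ih i e hi he0)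
      rw [End.mul_def] at h3
      rw [h1]
      simp only [← h2, Category.assoc, IsIso.hom_inv_id_assoc] at h3
      simpa only [Category.assoc] using h3
  have final : ∀ (a' b' : X) (ha' : a' = a) (hb' : b' = b) (hi : a' ∈ W i) (hj : b' ∈ W j),
      inv (k i _ hi) ≫ pathClass (p.cast ha' hb') ≫ k j _ hj ∈ H →
      inv (k i a ha) ≫ pathClass p ≫ k j b hb ∈ H := by
    rintro _ _ rfl rfl hi hj h
    exact h
  have h0 : p 0 ∈ W i := by rwa [p.source]
  have h1 : p 1 ∈ W j := by rwa [p.target]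
  refine final (p 0) (p 1) p.source p.target h0 h1 ?_
  rw [← Path.subpath_zero_one]
  have := claim n_max
  rw [h_max _ le_rfl] at this
  exact this i j h0 h1

/-- The image of a loop under a null-homotopic map is null-homotopic. -/
theorem pathClass_map_eq_of_nullhomotopic {f : C(X, Y)} (hf : f.Nullhomotopic) (p : Path a a) :
    pathClass (p.map f.continuous) = 𝟙 _ := by
  obtain ⟨y, ⟨F⟩⟩ := hf
  have h := Path.Homotopic.map_trans_evalAt F p
  rw [← pathClass_eq_iff, pathClass_trans, pathClass_trans] at h
  have : p.map (map_continuous (ContinuousMap.const X y)) =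
      Path.refl (ContinuousMap.const X y a) := rfl
  rw [this, pathClass_refl, Category.comp_id] at h
  exact (cancel_mono_id _).1 h

end PathClass

/-! ### Null-homotopic maps on the circle and the boundary of the square -/

section Circle

variable {Y : Type*} [TopologicalSpace Y]

instance fact_zero_lt_two_pi : Fact (0 < 2 * Real.pi) := ⟨Real.two_pi_pos⟩

/-- The loop running once around the circle `AddCircle T`. -/
def AddCircle.loop (T : ℝ) : Path (0 : AddCircle T) 0 where
  toFun t := ((T * t : ℝ) : AddCircle T)
  continuous_toFun := by
    exact (AddCircle.continuous_mk' T).comp (by fun_prop)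
  source' := by simp
  target' := by simp

/-- A homotopy relative to the end points gives the same constant track at both ends of the
interval, so its family of tracks descends to the circle. -/
theorem AddCircle.nullhomotopic_of_loop {T : ℝ} [hT : Fact (0 < T)] {v : C(AddCircle T, Y)}
    (h : pathClass ((AddCircle.loop T).map v.continuous) = 𝟙 _) : v.Nullhomotopic := by
  rw [← pathClass_refl, pathClass_eq_iff] at h
  obtain ⟨F⟩ := h
  let G : C(I, C(I, Y)) := (F.toContinuousMap.comp .prodSwap).curry
  have hG : ∀ s t, G s t = F (t, s) := fun _ _ => rfl
  let L : AddCircle T → C(I, Y) := AddCircle.liftIco T 0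
    fun s => G (Set.projIcc 0 1 zero_le_one (s / T))
  have hL : Continuous L := by
    refine AddCircle.liftIco_zero_continuous ?_ (by
      refine Continuous.continuousOn (G.continuous.comp (continuous_projIcc.comp ?_))
      fun_prop)
    ext t
    rw [hG, hG, div_self hT.out.ne', zero_div, Set.projIcc_left, Set.projIcc_right]
    change F (t, 0) = F (t, 1)
    rw [F.source, F.target]
  have key : ∀ z : AddCircle T, L z 0 = v z ∧ L z 1 = v 0 := by
    intro z
    obtain ⟨s, hs, rfl⟩ : ∃ s ∈ Set.Ico 0 (0 + T), (s : AddCircle T) = z := by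
      have := AddCircle.coe_image_Ico_eq T 0
      have hz : z ∈ (Set.univ : Set (AddCircle T)) := trivial
      rw [← this] at hz
      exact hz
    have hs' : s / T ∈ I := ⟨div_nonneg hs.1 hT.out.le,
      div_le_one_of_le₀ (by linarith [hs.2]) hT.out.le⟩
    have : L s = G ⟨s / T, hs'⟩ := by
      simp only [L]
      rw [AddCircle.liftIco_coe_apply hs, Set.projIcc_of_mem zero_le_one hs']
    rw [this, hG, hG]
    constructor
    · rw [F.apply_zero]
      change v ((T * (s / T) : ℝ) : AddCircle T) = _
      rw [mul_div_cancel₀ _ hT.out.ne']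
    · rw [F.apply_one]
      rfl
  exact ⟨v 0, ⟨⟨(ContinuousMap.uncurry ⟨L, hL⟩).comp .prodSwap, fun z => (key z).1,
    fun z => (key z).2⟩⟩⟩

/-- The boundary of the square is a retract of the circle. -/
theorem exists_leftInverse_sphere_circle :
    ∃ (φ : C(Metric.sphere (0 : Fin 2 → ℝ) 1, Circle))
      (θ : C(Circle, Metric.sphere (0 : Fin 2 → ℝ) 1)), Function.LeftInverse θ φ := by
  have hne : ∀ y : Metric.sphere (0 : Fin 2 → ℝ) 1, (⟨y.1 0, y.1 1⟩ : ℂ) ≠ 0 := by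
    rintro ⟨y, hy⟩ h
    have h0 : y 0 = 0 := congr_arg Complex.re h
    have h1 : y 1 = 0 := congr_arg Complex.im h
    have : y = 0 := by ext i; fin_cases i <;> simp [h0, h1]
    simp [this] at hy
  have hne' : ∀ z : Circle, ![(z : ℂ).re, (z : ℂ).im] ≠ 0 := by
    intro z h
    have h0 : (z : ℂ).re = 0 := congr_fun h 0
    have h1 : (z : ℂ).im = 0 := congr_fun h 1
    exact Circle.coe_ne_zero z (Complex.ext h0 h1)
  let φ : C(Metric.sphere (0 : Fin 2 → ℝ) 1, Circle) :=
    ⟨fun y => ⟨(‖(⟨y.1 0, y.1 1⟩ : ℂ)‖⁻¹ : ℝ) • (⟨y.1 0, y.1 1⟩ : ℂ), by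
      rw [← SetLike.mem_coe, Submonoid.coe_unitSphere, mem_sphere_zero_iff_norm, norm_smul,
        norm_inv, norm_norm, inv_mul_cancel₀ (norm_ne_zero_iff.2 (hne y))]⟩, by
      have h : Continuous fun y : Metric.sphere (0 : Fin 2 → ℝ) 1 => (⟨y.1 0, y.1 1⟩ : ℂ) :=
        Complex.equivRealProdCLM.symm.continuous.comp (f := fun y : Metric.sphere (0 : Fin 2 → ℝ) 1
          => (y.1 0, y.1 1)) (((continuous_apply 0).comp continuous_subtype_val).prodMk
            ((continuous_apply 1).comp continuous_subtype_val))
      exact Continuous.subtype_mk ((h.norm.inv₀ fun y => norm_ne_zero_iff.2 (hne y)).smul h) _⟩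
  let θ : C(Circle, Metric.sphere (0 : Fin 2 → ℝ) 1) :=
    ⟨fun z => ⟨‖![(z : ℂ).re, (z : ℂ).im]‖⁻¹ • ![(z : ℂ).re, (z : ℂ).im], by
      rw [mem_sphere_zero_iff_norm, norm_smul, norm_inv, norm_norm,
        inv_mul_cancel₀ (norm_ne_zero_iff.2 (hne' z))]⟩, by
      have h : Continuous fun z : Circle => ![(z : ℂ).re, (z : ℂ).im] := by
        refine continuous_pi fun i => ?_
        fin_cases i
        · exact Complex.continuous_re.comp continuous_subtype_val
        · exact Complex.continuous_im.comp continuous_subtype_val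
      exact Continuous.subtype_mk ((h.norm.inv₀ fun y => norm_ne_zero_iff.2 (hne' y)).smul h) _⟩
  refine ⟨φ, θ, fun y => Subtype.ext ?_⟩
  set c : ℝ := ‖(⟨y.1 0, y.1 1⟩ : ℂ)‖⁻¹ with hc
  have hc0 : 0 < c := inv_pos.2 (norm_pos_iff.2 (hne y))
  have hy : ![((φ y : Circle) : ℂ).re, ((φ y : Circle) : ℂ).im] = c • y.1 := by
    ext i
    fin_cases i
    · exact Complex.smul_re c _
    · exact Complex.smul_im c _
  change ‖![((φ y : Circle) : ℂ).re, ((φ y : Circle) : ℂ).im]‖⁻¹ •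
    ![((φ y : Circle) : ℂ).re, ((φ y : Circle) : ℂ).im] = y.1
  rw [hy, norm_smul, mem_sphere_zero_iff_norm.1 y.2, mul_one, Real.norm_of_nonneg hc0.le, smul_smul,
    inv_mul_cancel₀ hc0.ne', one_smul]

/-- A map from the boundary of the square is null-homotopic if its composite with a map that is
injective on loops is. -/
theorem homotopic_const_of_comp_nullhomotopic {X : Type*} [TopologicalSpace X]
    [PathConnectedSpace Y] {e : C(Y, X)} {y₀ : Y}
    (he : ∀ p : Path y₀ y₀, pathClass (p.map e.continuous) = 𝟙 _ → pathClass p = 𝟙 _)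
    {u : C(Metric.sphere (0 : Fin 2 → ℝ) 1, Y)} (hu : (e.comp u).Nullhomotopic) :
    u.Homotopic (ContinuousMap.const _ y₀) := by
  obtain ⟨φ', θ', hθ'⟩ := exists_leftInverse_sphere_circle
  let φ : C(Metric.sphere (0 : Fin 2 → ℝ) 1, AddCircle (2 * Real.pi)) :=
    ⟨fun y => AddCircle.homeomorphCircle'.symm (φ' y), by fun_prop⟩
  let θ : C(AddCircle (2 * Real.pi), Metric.sphere (0 : Fin 2 → ℝ) 1) :=
    ⟨fun z => θ' (AddCircle.homeomorphCircle' z), by fun_prop⟩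
  let v : C(AddCircle (2 * Real.pi), Y) := u.comp θ
  have hv : (e.comp v).Nullhomotopic := hu.comp_left θ
  obtain ⟨δ⟩ := PathConnectedSpace.joined y₀ (v 0)
  set γ : Path (v 0) (v 0) := (AddCircle.loop _).map v.continuous
  have h1 : pathClass (γ.map e.continuous) = 𝟙 _ :=
    pathClass_map_eq_of_nullhomotopic hv (AddCircle.loop _)
  -- Conjugating by `δ` moves the loop to the base point `y₀`, the only place where `he` applies.
  have h2 : pathClass (δ.trans (γ.trans δ.symm)) = 𝟙 _ := by
    apply he
    rw [Path.map_trans, Path.map_trans, pathClass_trans, pathClass_trans, h1, ← Path.map_symm,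
      pathClass_symm]
    simp
  have h3 : pathClass γ = 𝟙 _ := by
    rw [pathClass_trans, pathClass_trans, pathClass_symm] at h2
    simpa using congr_arg (fun m => inv (pathClass δ) ≫ m ≫ pathClass δ) h2
  obtain ⟨y, hy⟩ := (AddCircle.nullhomotopic_of_loop h3).comp_left φ
  have hvu : v.comp φ = u := by
    ext z
    change u (θ' (AddCircle.homeomorphCircle' (AddCircle.homeomorphCircle'.symm (φ' z)))) = u z
    rw [Homeomorph.apply_symm_apply, hθ' z]
  rw [hvu] at hy
  exact hy.trans (by
    obtain ⟨q⟩ := PathConnectedSpace.joined y y₀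
    exact ⟨q.toHomotopyConst⟩)

end Circle

theorem HomotopicOn.of_joined {X Z : Type*} [TopologicalSpace X] [TopologicalSpace Z] {U : Set X}
    {a b : Z} (h : Joined a b) : HomotopicOn U (fun _ => a) fun _ => b := by
  obtain ⟨p⟩ := h
  exact ⟨fun _ => p, continuousOn_const, fun _ _ => ⟨p.source, p.target⟩⟩

/-- A contraction of `U` in `X` gives path classes from the points of `U` to the centre that are
compatible with paths in `U`. -/
theorem HomotopicOn.exists_coherent_pathClass {X : Type*} [TopologicalSpace X] {U : Set X} {c : X}
    (H : HomotopicOn U id fun _ => c) :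
    ∃ k : ∀ x ∈ U, FundamentalGroupoid.mk x ⟶ FundamentalGroupoid.mk c,
      ∀ (x y : X) (hx : x ∈ U) (hy : y ∈ U) (p : Path x y), (∀ t, p t ∈ U) →
        pathClass p ≫ k y hy = k x hx := by
  obtain ⟨F⟩ := H.homotopic
  refine ⟨fun x hx => pathClass (a := x) (b := c) (F.evalAt ⟨x, hx⟩), fun x y hx hy p hp => ?_⟩
  let p' : Path (⟨x, hx⟩ : U) ⟨y, hy⟩ :=
    { toFun := fun t => ⟨p t, hp t⟩
      continuous_toFun := p.continuous.subtype_mk hp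
      source' := Subtype.ext p.source
      target' := Subtype.ext p.target }
  have h := Path.Homotopic.map_trans_evalAt F p'
  rw [← pathClass_eq_iff, pathClass_trans, pathClass_trans] at h
  exact h.trans (Category.comp_id _)

/-! ### The suspension of a discrete set -/

/-- The equivalence relation collapsing the two ends of `J × I`. -/
def suspensionSetoid (J : Type*) : Setoid (Σ _ : J, I) where
  r x y := x.2 = y.2 ∧ (x.1 = y.1 ∨ x.2 = 0 ∨ x.2 = 1)
  iseqv := ⟨fun _ => ⟨rfl, Or.inl rfl⟩, fun h => by grind, fun h h' => by grind⟩

/-- The unreduced suspension of a discrete set `J`. -/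
def DiscreteSuspension (J : Type*) : Type _ := Quotient (suspensionSetoid J)

namespace DiscreteSuspension

variable {J : Type*}

instance : TopologicalSpace (DiscreteSuspension J) :=
  inferInstanceAs (TopologicalSpace (Quotient (suspensionSetoid J)))

/-- The point at height `t` on the meridian `j`. -/
def mk (j : J) (t : I) : DiscreteSuspension J := Quotient.mk (suspensionSetoid J) ⟨j, t⟩

theorem isQuotientMap_mk :
    IsQuotientMap (fun x : Σ _ : J, I => (mk x.1 x.2 : DiscreteSuspension J)) :=
  isQuotientMap_quotient_mk'

theorem continuous_mk (j : J) : Continuous (mk j : I → DiscreteSuspension J) :=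
  isQuotientMap_mk.continuous.comp (f := fun t : I => (⟨j, t⟩ : Σ _ : J, I))
    (@continuous_sigmaMk _ (fun _ : J => I) _ j)

theorem mk_eq_mk_iff {i j : J} {s t : I} :
    mk i s = mk j t ↔ s = t ∧ (i = j ∨ s = 0 ∨ s = 1) :=
  Quotient.eq (r := suspensionSetoid J)

theorem exists_rep (x : DiscreteSuspension J) : ∃ j t, x = mk j t := by
  obtain ⟨⟨j, t⟩, rfl⟩ := isQuotientMap_mk.surjective x
  exact ⟨j, t, rfl⟩

/-- The height function of the suspension. -/
def height : C(DiscreteSuspension J, I) where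
  toFun := Quotient.lift (fun x : Σ _ : J, I => x.2) fun _ _ h => h.1
  continuous_toFun := isQuotientMap_mk.continuous_iff.2 (by
    refine continuous_sigma fun j => ?_
    exact continuous_id)

/-- A deformation of the interval that respects the end points induces a deformation of the
corresponding part of the suspension. -/
theorem homotopicOn_height_preimage (j₀ : J) {D : Set I} (hD : IsOpen D) (m : C(I × I, I)) {c : I}
    (hc : c = 0 ∨ c = 1) (hm0 : ∀ t, m (t, 0) = t) (hm1 : ∀ t, m (t, 1) = c)
    (hm : ∀ t ∈ D, t = 0 ∨ t = 1 → ∀ s, m (t, s) = 0 ∨ m (t, s) = 1) :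
    HomotopicOn (height ⁻¹' D) id fun _ : DiscreteSuspension J => mk j₀ c := by
  choose j t hjt using exists_rep (J := J)
  let G : J → C(I, C(I, DiscreteSuspension J)) := fun j =>
    ContinuousMap.curry ⟨fun p => mk j (m p), (continuous_mk j).comp m.continuous⟩
  have hG : ∀ j t s, G j t s = mk j (m (t, s)) := fun _ _ _ => rfl
  -- The chosen representative is ambiguous only at a pole, and there `hm` keeps the whole track at
  -- poles, where the meridian does not matter.
  have key : ∀ j' t', t' ∈ D → G (j (mk j' t')) (t (mk j' t')) = G j' t' := by
    intro j' t' ht'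
    have h := hjt (mk j' t')
    rw [mk_eq_mk_iff] at h
    obtain ⟨h, h'⟩ := h
    rw [← h]
    ext s
    rw [hG, hG, mk_eq_mk_iff]
    refine ⟨rfl, ?_⟩
    rcases h' with h' | h'
    · exact Or.inl h'.symm
    · exact Or.inr (hm _ ht' h' s)
  refine ⟨fun x => G (j x) (t x), ?_, ?_⟩
  · rw [isQuotientMap_mk.continuousOn_isOpen_iff (hD.preimage height.continuous)]
    refine ContinuousOn.congr (f := fun x : Σ _ : J, I => G x.1 x.2) ?_ ?_
    · exact Continuous.continuousOn (continuous_sigma fun j => (G j).continuous)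
    · rintro ⟨j', t'⟩ h
      exact key j' t' h
  · intro x _
    rw [hG, hG, hm0, hm1, ← hjt, mk_eq_mk_iff]
    exact ⟨rfl, rfl, Or.inr hc⟩

theorem homotopicOn_lower (j₀ : J) :
    HomotopicOn (height ⁻¹' {t | t ≠ 1}) id fun _ : DiscreteSuspension J => mk j₀ 0 := by
  refine homotopicOn_height_preimage j₀ isOpen_ne ⟨fun p => p.1 * σ p.2, by fun_prop⟩
    (Or.inl rfl) (by simp) (by simp) ?_
  rintro t ht (rfl | rfl) s
  · simp
  · exact (ht rfl).elim

theorem homotopicOn_upper (j₀ : J) :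
    HomotopicOn (height ⁻¹' {t | t ≠ 0}) id fun _ : DiscreteSuspension J => mk j₀ 1 := by
  refine homotopicOn_height_preimage j₀ isOpen_ne ⟨fun p => σ (σ p.1 * σ p.2), by fun_prop⟩
    (Or.inr rfl) (by simp) (by simp) ?_
  rintro t ht (rfl | rfl) s
  · exact (ht rfl).elim
  · simp

/-- The meridian through `j`, with end points expressed on the meridian `j₀`. -/
def meridian (j₀ j : J) : Path (mk j₀ 0) (mk j₀ 1) where
  toFun := mk j
  continuous_toFun := continuous_mk j
  source' := by simp [mk_eq_mk_iff]
  target' := by simp [mk_eq_mk_iff]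

/-- The loop running up the meridian `j` and down the meridian `j₀`. -/
noncomputable def loop (j₀ j : J) : Path (mk j₀ 0) (mk j₀ 0) :=
  (meridian j₀ j).trans (meridian j₀ j₀).symm

/-- The height bounds keep the two halves inside the complements of the opposite poles, where the
contractions provide coherent path classes. -/
theorem exists_meridian_subdivision (j₀ j : J) (t : I) :
    ∃ (p : Path (mk j₀ 0) (mk j t)) (q : Path (mk j t) (mk j₀ 1)), (∀ s, height (p s) ≤ t) ∧
      (∀ s, t ≤ height (q s)) ∧ pathClass p ≫ pathClass q = pathClass (meridian j₀ j) := by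
  refine ⟨((meridian j₀ j).subpath 0 t).cast (meridian j₀ j).source.symm rfl,
    ((meridian j₀ j).subpath t 1).cast rfl (meridian j₀ j).target.symm, fun s => ?_, fun s => ?_,
    ?_⟩
  · have : ((meridian j₀ j).subpath 0 t) s ∈ Set.range ((meridian j₀ j).subpath 0 t) := ⟨s, rfl⟩
    rw [Path.range_subpath_of_le _ _ _ t.2.1] at this
    obtain ⟨s', hs', h⟩ := this
    change height (((meridian j₀ j).subpath 0 t) s) ≤ t
    rw [← h]
    exact hs'.2
  · have : ((meridian j₀ j).subpath t 1) s ∈ Set.range ((meridian j₀ j).subpath t 1) := ⟨s, rfl⟩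
    rw [Path.range_subpath_of_le _ _ _ t.2.2] at this
    obtain ⟨s', hs', h⟩ := this
    change t ≤ height (((meridian j₀ j).subpath t 1) s)
    rw [← h]
    exact hs'.1
  · rw [← pathClass_trans, pathClass_eq_iff]
    have h : (((meridian j₀ j).subpath 0 t).trans ((meridian j₀ j).subpath t 1)).Homotopic
      ((meridian j₀ j).subpath 0 1) := ⟨Path.Homotopy.subpathTransSubpath _ _ _ _⟩
    rw [Path.subpath_zero_one] at h
    exact h.pathCast (meridian j₀ j).source.symm (meridian j₀ j).target.symm

instance [Nonempty J] : PathConnectedSpace (DiscreteSuspension J) where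
  nonempty := ⟨mk (Classical.arbitrary J) 0⟩
  joined := by
    have h : ∀ x : DiscreteSuspension J, Joined (mk (Classical.arbitrary J) 0) x := by
      intro x
      obtain ⟨j, t, rfl⟩ := exists_rep x
      exact ⟨((meridian (Classical.arbitrary J) j).subpath 0 t).cast
        (meridian (Classical.arbitrary J) j).source.symm rfl⟩
    exact fun x y => (h x).symm.trans (h y)

/-- The fundamental group of the suspension of a discrete set is generated by the loops along pairs
of meridians. -/
theorem pathClass_mem_of_forall_loop_mem (j₀ : J)
    (H : Subgroup (FundamentalGroup (DiscreteSuspension J) (mk j₀ 0)))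
    (hH : ∀ j, (pathClass (loop j₀ j) : FundamentalGroup _ _) ∈ H)
    (p : Path (mk j₀ 0 : DiscreteSuspension J) (mk j₀ 0)) :
    (pathClass p : FundamentalGroup _ _) ∈ H := by
  obtain ⟨k₀, hk₀⟩ := (homotopicOn_lower j₀).exists_coherent_pathClass
  obtain ⟨k₁, hk₁⟩ := (homotopicOn_upper j₀).exists_coherent_pathClass
  have hN : mk j₀ 0 ∈ height ⁻¹' {t : I | t ≠ 1} := zero_ne_one
  have hS : mk j₀ 1 ∈ height ⁻¹' {t : I | t ≠ 0} := one_ne_zero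
  let W : Bool → Set (DiscreteSuspension J) :=
    fun b => if b then height ⁻¹' {t | t ≠ 0} else height ⁻¹' {t | t ≠ 1}
  -- Each class is normalised at its own pole, and the upper one returns along the meridian `j₀`.
  -- The transition class at a point of the meridian `j` is then exactly that of `loop j₀ j`.
  let k : ∀ i, ∀ x ∈ W i, FundamentalGroupoid.mk x ⟶ FundamentalGroupoid.mk (mk j₀ 0) :=
    fun i => match i with
    | false => fun x hx => k₀ x hx ≫ inv (k₀ _ hN)
    | true => fun x hx => k₁ x hx ≫ inv (k₁ _ hS) ≫ inv (pathClass (meridian j₀ j₀))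
  have htrans : ∀ x (h₀ : x ∈ W false) (h₁ : x ∈ W true),
      (inv (k false x h₀) ≫ k true x h₁ : FundamentalGroup _ _) ∈ H := by
    intro x h₀ h₁
    obtain ⟨j, t, rfl⟩ := exists_rep x
    obtain ⟨q, r, hq, hr, hqr⟩ := exists_meridian_subdivision j₀ j t
    have e₀ := hk₀ (mk j₀ 0) (mk j t) hN h₀ q
      fun s => ne_of_lt ((hq s).trans_lt (lt_of_le_of_ne t.2.2 h₀))
    have e₁ := hk₁ (mk j t) (mk j₀ 1) h₁ hS r
      fun s => ne_of_gt ((lt_of_le_of_ne (unitInterval.nonneg' (t := t)) (Ne.symm h₁)).trans_le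
        (hr s))
    have h := hH j
    rw [loop, pathClass_trans, pathClass_symm, ← hqr] at h
    convert h using 1
    simp only [k, ← e₁, ← e₀]
    simp
  have hone : ∀ b x (h : x ∈ W b), (inv (k b x h) ≫ k b x h : FundamentalGroup _ _) ∈ H := by
    intro b x h
    rw [IsIso.inv_hom_id]
    exact H.one_mem
  have h := pathClass_mem_of_open_cover (W := W)
    (by
      rintro (_ | _)
      · exact isOpen_ne.preimage height.continuous
      · exact isOpen_ne.preimage height.continuous)
    (by
      refine Set.eq_univ_of_forall fun x => Set.mem_iUnion.2 ?_
      by_cases hx : height x = 0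
      · exact ⟨false, fun h => zero_ne_one (hx.symm.trans h)⟩
      · exact ⟨true, hx⟩)
    k
    (by
      rintro (_ | _) x y hx hy q hq
      · simp only [k, ← hk₀ x y hx hy q hq, Category.assoc]
      · simp only [k, ← hk₁ x y hx hy q hq, Category.assoc])
    H
    (by
      rintro (_ | _) (_ | _) x h h'
      · exact hone false x h
      · exact htrans x h h'
      · have := H.inv_mem (htrans x h' h)
        have e : (inv (k true x h) ≫ k false x h') = inv (inv (k false x h') ≫ k true x h) := by
          simp
        rw [e, ← Groupoid.inv_eq_inv]
        exact this
      · exact hone true x h)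
    p false false hN hN
  have hk1 : k false _ hN = 𝟙 _ := by simp [k]
  rw [hk1] at h
  simpa using h

section Lift

variable {X : Type*} [TopologicalSpace X] {x₀ : X}

/-- The map out of the suspension given by a family of loops. -/
def lift (γ : J → Path x₀ x₀) : C(DiscreteSuspension J, X) where
  toFun := Quotient.lift (fun x : Σ _ : J, I => γ x.1 x.2) (by
    rintro ⟨i, s⟩ ⟨j, t⟩ ⟨h, h'⟩
    dsimp only at h h' ⊢
    subst h
    rcases h' with rfl | rfl | rfl <;> simp)
  continuous_toFun := isQuotientMap_mk.continuous_iff.2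
    (continuous_sigma fun j => (γ j).continuous)

end Lift

end DiscreteSuspension

/-! ### The model of a free fundamental group -/

/-- A space with free fundamental group receives a map, bijective on fundamental groups, from
a space covered by two open subsets that are contractible in it. -/
theorem exists_map_bijective_on_loops {X : Type u} [TopologicalSpace X] (x₀ : X)
    (hfree : IsFreeGroup (FundamentalGroup X x₀)) :
    ∃ (Y : Type u) (_ : TopologicalSpace Y) (_ : PathConnectedSpace Y) (e : C(Y, X)) (y₀ : Y)
      (W₀ W₁ : Set Y), IsOpen W₀ ∧ IsOpen W₁ ∧ W₀ ∪ W₁ = Set.univ ∧ y₀ ∈ W₀ ∧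
      HomotopicOn W₀ id (fun _ => y₀) ∧ HomotopicOn W₁ id (fun _ => y₀) ∧
      (∀ q : Path (e y₀) (e y₀), ∃ p : Path y₀ y₀, (p.map e.continuous).Homotopic q) ∧
      ∀ p : Path y₀ y₀, pathClass (p.map e.continuous) = 𝟙 _ → pathClass p = 𝟙 _ := by
  obtain ⟨ι, ⟨b⟩⟩ := hfree.nonempty_basis
  choose γ hγ using fun i => pathClass_surjective (a := x₀) (b := x₀) (b i)
  -- The extra meridian `none` is sent to the constant path, so the loop along `some i` and back
  -- along `none` maps to the class of the basis element `b i`.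
  let γ' : Option ι → Path x₀ x₀ := fun j => j.elim (Path.refl x₀) γ
  let e := DiscreteSuspension.lift γ'
  let N : DiscreteSuspension (Option ι) := DiscreteSuspension.mk none 0
  let φ : FundamentalGroup _ N →* FundamentalGroup X x₀ := FundamentalGroup.map e N
  have hφ : ∀ p : Path N N, φ (pathClass p) = pathClass (p.map e.continuous) := fun _ => rfl
  -- Freeness enters here: it provides a section `s` of `φ`. Since the loops generate, `s` is onto,
  -- which makes `φ` injective as well.
  let s : FundamentalGroup X x₀ →* FundamentalGroup _ N :=
    b.lift fun i => pathClass (DiscreteSuspension.loop none (some i))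
  have hφs : φ.comp s = MonoidHom.id _ := by
    refine b.ext_hom _ _ fun i => ?_
    have h1 : s (b i) = pathClass (DiscreteSuspension.loop none (some i)) := congr_fun (b.lift.symm_apply_apply _) i
    have h2 : (DiscreteSuspension.meridian none none).map e.continuous = Path.refl x₀ := rfl
    have h3 : (DiscreteSuspension.meridian none (some i)).map e.continuous = γ i := rfl
    rw [MonoidHom.comp_apply, h1, hφ, DiscreteSuspension.loop, Path.map_trans, ← Path.map_symm, h2,
      h3, MonoidHom.id_apply, ← hγ i]
    change pathClass ((γ i).trans (Path.refl x₀).symm) = _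
    rw [pathClass_trans, pathClass_symm, pathClass_refl]
    simp
  have hs : Function.Surjective s := by
    rw [← MonoidHom.range_eq_top, eq_top_iff]
    intro m _
    obtain ⟨p, rfl⟩ := pathClass_surjective m
    refine DiscreteSuspension.pathClass_mem_of_forall_loop_mem none s.range ?_ p
    rintro (_ | i)
    · rw [DiscreteSuspension.loop, pathClass_trans, pathClass_symm, IsIso.hom_inv_id]
      exact s.range.one_mem
    · exact ⟨b i, congr_fun (b.lift.symm_apply_apply _) i⟩
  refine ⟨DiscreteSuspension (Option ι), inferInstance, inferInstance, e, N,
    DiscreteSuspension.height ⁻¹' {t | t ≠ 1}, DiscreteSuspension.height ⁻¹' {t | t ≠ 0},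
    isOpen_ne.preimage (map_continuous _), isOpen_ne.preimage (map_continuous _), ?_, zero_ne_one,
    DiscreteSuspension.homotopicOn_lower none,
    (DiscreteSuspension.homotopicOn_upper none).trans
      (.of_joined (PathConnectedSpace.joined _ _)), ?_, ?_⟩
  · rw [← Set.preimage_union, Set.preimage_eq_univ_iff]
    intro t _
    by_cases ht : t = 1
    · exact Or.inr (by simp [ht])
    · exact Or.inl ht
  · intro q
    obtain ⟨p, hp⟩ := pathClass_surjective (s (pathClass (a := x₀) (b := x₀) q))
    refine ⟨p, ?_⟩
    rw [← pathClass_eq_iff]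
    change φ (pathClass p) = _
    rw [hp]
    exact DFunLike.congr_fun hφs _
  · intro p hp
    obtain ⟨m, hm⟩ := hs (pathClass p)
    have h1 : φ (s m) = 1 := by rw [hm]; exact hp
    have h2 : m = 1 := (DFunLike.congr_fun hφs m).symm.trans h1
    rw [← hm, h2]
    exact map_one s

/-! ### Closedness, continuity and extension over cells -/

section CWComplex

open Metric

variable {X : Type*} [TopologicalSpace X] [CWComplex (Set.univ : Set X)]

theorem joined_map {n : ℕ} (j : RelCWComplex.cell (Set.univ : Set X) n)
    {y z : Fin n → ℝ} (hy : y ∈ closedBall 0 1) (hz : z ∈ closedBall 0 1) :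
    Joined (RelCWComplex.map n j y) (RelCWComplex.map n j z) := by
  have h : IsPathConnected (RelCWComplex.map n j '' closedBall 0 1) :=
    ((convex_closedBall 0 1).isPathConnected ⟨y, hy⟩).image' (RelCWComplex.continuousOn n j)
  exact (h.joinedIn _ ⟨y, hy, rfl⟩ _ ⟨z, hz, rfl⟩).joined

variable [T2Space X]

/-- The intersection is the image of a compact subset of the ball, and `X` is Hausdorff. -/
theorem isClosed_inter_closedCell_of_preimage {A : Set X} {n : ℕ}
    {j : RelCWComplex.cell (Set.univ : Set X) n}
    (h : IsClosed (closedBall 0 1 ∩ RelCWComplex.map n j ⁻¹' A)) :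
    IsClosed (A ∩ RelCWComplex.closedCell n j) := by
  have : A ∩ RelCWComplex.closedCell n j =
      RelCWComplex.map n j '' (closedBall 0 1 ∩ RelCWComplex.map n j ⁻¹' A) := by
    rw [RelCWComplex.closedCell, Set.image_inter_preimage, Set.inter_comm]
  rw [this]
  exact (((isCompact_closedBall _ _).of_isClosed_subset h Set.inter_subset_left).image_of_continuousOn
    ((RelCWComplex.continuousOn n j).mono Set.inter_subset_left)).isClosed

/-- A set is closed if its preimages under all characteristic maps are. -/
theorem isClosed_of_forall_preimage_map {A : Set X}
    (h : ∀ (n : ℕ) (j : RelCWComplex.cell (Set.univ : Set X) n),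
      IsClosed (closedBall 0 1 ∩ RelCWComplex.map n j ⁻¹' A)) : IsClosed A :=
  (CWComplex.closed _ A (Set.subset_univ _)).2 fun n j =>
    isClosed_inter_closedCell_of_preimage (h n j)

/-- Open cells of dimension at least `n` miss `A`, so only the lower cells have to be tested. -/
theorem isClosed_of_subset_skeletonLT {A : Set X} {n : ℕ}
    (hA : A ⊆ RelCWComplex.skeletonLT (Set.univ : Set X) n)
    (h : ∀ m < n, ∀ j : RelCWComplex.cell (Set.univ : Set X) m,
      IsClosed (closedBall 0 1 ∩ RelCWComplex.map m j ⁻¹' A)) : IsClosed A := by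
  refine CWComplex.isClosed_of_disjoint_openCell_or_isClosed_inter_closedCell
    (C := (Set.univ : Set X)) (Set.subset_univ _) fun m _ j => ?_
  rcases lt_or_ge m n with hm | hm
  · exact Or.inr (isClosed_inter_closedCell_of_preimage (h m hm j))
  · exact Or.inl ((RelCWComplex.disjoint_skeletonLT_openCell (by exact_mod_cast hm)).mono_left hA)

/-- Continuity on an open subset can be checked on the characteristic maps. -/
theorem continuousOn_of_forall_comp_map {Z : Type*} [TopologicalSpace Z] {P : Set X}
    (hP : IsOpen P) {f : X → Z}
    (h : ∀ (n : ℕ) (j : RelCWComplex.cell (Set.univ : Set X) n),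
      ContinuousOn (f ∘ RelCWComplex.map n j) (closedBall 0 1 ∩ RelCWComplex.map n j ⁻¹' P)) :
    ContinuousOn f P := by
  rw [continuousOn_open_iff hP]
  intro O hO
  rw [← isClosed_compl_iff]
  refine isClosed_of_forall_preimage_map fun n j => ?_
  obtain ⟨V, hV, hVP⟩ := (continuousOn_iff'.1 (RelCWComplex.continuousOn n j)) P hP
  obtain ⟨W, hW, hWO⟩ := (continuousOn_iff'.1 (h n j)) O hO
  have : closedBall 0 1 ∩ RelCWComplex.map n j ⁻¹' (P ∩ f ⁻¹' O)ᶜ =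
      closedBall 0 1 ∩ (V ∩ W)ᶜ := by
    ext y
    have e1 := Set.ext_iff.1 hVP y
    have e2 := Set.ext_iff.1 hWO y
    simp only [Set.mem_inter_iff, Set.mem_preimage, Set.mem_compl_iff, Function.comp_apply] at *
    tauto
  rw [this]
  exact isClosed_closedBall.inter (hV.inter hW).isClosed_compl

theorem map_mem_skeletonLT {n m : ℕ} (h : n < m) (j : RelCWComplex.cell (Set.univ : Set X) n)
    {y : Fin n → ℝ} (hy : y ∈ closedBall 0 1) :
    RelCWComplex.map n j y ∈ (RelCWComplex.skeletonLT (Set.univ : Set X) m : Set X) :=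
  RelCWComplex.skeletonLT_mono (by exact_mod_cast h)
    (RelCWComplex.closedCell_subset_skeletonLT n j ⟨y, hy, rfl⟩)

theorem map_mem_skeletonLT_of_sphere {n : ℕ} (j : RelCWComplex.cell (Set.univ : Set X) n)
    {y : Fin n → ℝ} (hy : y ∈ sphere 0 1) :
    RelCWComplex.map n j y ∈ (RelCWComplex.skeletonLT (Set.univ : Set X) n : Set X) :=
  RelCWComplex.cellFrontier_subset_skeletonLT n j ⟨y, hy, rfl⟩

theorem continuousOn_skeletonLT_succ {Z : Type*} [TopologicalSpace Z] {n : ℕ} {f : X → Z}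
    (hf : ContinuousOn f (RelCWComplex.skeletonLT (Set.univ : Set X) n))
    (h : ∀ j : RelCWComplex.cell (Set.univ : Set X) n,
      ContinuousOn (f ∘ RelCWComplex.map n j) (closedBall 0 1)) :
    ContinuousOn f (RelCWComplex.skeletonLT (Set.univ : Set X) (n + 1 : ℕ)) := by
  have hall : ∀ m < n + 1, ∀ j : RelCWComplex.cell (Set.univ : Set X) m,
      ContinuousOn (f ∘ RelCWComplex.map m j) (closedBall 0 1) := by
    intro m hm j
    rcases Nat.lt_succ_iff_lt_or_eq.1 hm with hm | rfl
    · exact hf.comp (RelCWComplex.continuousOn m j) fun y hy => map_mem_skeletonLT hm j hy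
    · exact h j
  rw [continuousOn_iff_isClosed]
  intro T hT
  refine ⟨f ⁻¹' T ∩ RelCWComplex.skeletonLT (Set.univ : Set X) (n + 1 : ℕ), ?_, by simp⟩
  refine isClosed_of_subset_skeletonLT (n := n + 1) Set.inter_subset_right fun m hm j => ?_
  convert (hall m hm j).preimage_isClosed_of_isClosed isClosed_closedBall hT using 1
  ext y
  simp only [Set.mem_inter_iff, Set.mem_preimage, Function.comp_apply]
  exact ⟨fun h => ⟨h.1, h.2.1⟩, fun h => ⟨h.1, h.2, map_mem_skeletonLT hm j h.1⟩⟩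

/-- A function on the skeleton can be extended over the next cells by any functions that agree with
it on the boundary. -/
theorem exists_cell_extension {Z : Type*} {n : ℕ} (f : X → Z)
    (F : RelCWComplex.cell (Set.univ : Set X) n → (Fin n → ℝ) → Z)
    (hF : ∀ j, ∀ y ∈ sphere 0 1, F j y = f (RelCWComplex.map n j y)) :
    ∃ g : X → Z, Set.EqOn g f (RelCWComplex.skeletonLT (Set.univ : Set X) n) ∧
      ∀ j, ∀ y ∈ closedBall 0 1, g (RelCWComplex.map n j y) = F j y := by
  classical
  let g : X → Z := fun x =>
    if h : ∃ j : RelCWComplex.cell (Set.univ : Set X) n, x ∈ RelCWComplex.openCell n j then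
      F h.choose ((RelCWComplex.map n h.choose).symm x) else f x
  have hg : Set.EqOn g f (RelCWComplex.skeletonLT (Set.univ : Set X) n) := by
    intro x hx
    refine dif_neg ?_
    rintro ⟨j, hj⟩
    exact Set.disjoint_left.1 (RelCWComplex.disjoint_skeletonLT_openCell le_rfl) hx hj
  refine ⟨g, hg, fun j y hy => ?_⟩
  by_cases hy1 : y ∈ sphere 0 1
  · rw [hF j y hy1]
    exact hg (map_mem_skeletonLT_of_sphere j hy1)
  · have hyb : y ∈ ball 0 1 := by
      rw [mem_ball]
      exact lt_of_le_of_ne hy hy1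
    have hex : ∃ i : RelCWComplex.cell (Set.univ : Set X) n,
      RelCWComplex.map n j y ∈ RelCWComplex.openCell n i := ⟨j, y, hyb, rfl⟩
    -- Distinct open cells are disjoint.
    have hch : hex.choose = j := by
      by_contra hne
      refine Set.disjoint_left.1 (RelCWComplex.disjoint_openCell_of_ne (C := (Set.univ : Set X))
        (i := hex.choose) (j := j) (n := n) (m := n) ?_) hex.choose_spec ⟨y, hyb, rfl⟩
      simpa using hne
    simp only [g]
    rw [dif_pos hex, hch, PartialEquiv.left_inv]
    rwa [RelCWComplex.source_eq]

/-- Closed cells are path connected, so a union of path components contains or misses each of them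
and is therefore closed. A path component and its complement are both such unions. -/
theorem CWComplex.pathConnectedSpace [ConnectedSpace X] : PathConnectedSpace X := by
  obtain ⟨x⟩ := (inferInstance : Nonempty X)
  have key : ∀ A : Set X, (∀ y z, Joined y z → y ∈ A → z ∈ A) → IsClosed A := by
    intro A hA
    refine isClosed_of_forall_preimage_map fun n j => ?_
    rcases (closedBall 0 1 ∩ RelCWComplex.map n j ⁻¹' A).eq_empty_or_nonempty with h | ⟨y, hy, hyA⟩
    · rw [h]; exact isClosed_empty
    · rw [Set.inter_eq_left.2]
      · exact isClosed_closedBall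
      · exact fun z hz => hA _ _ (joined_map j hy hz) hyA
  have h1 : IsClosed {y | Joined x y} := key _ fun y z h h' => h'.trans h
  have h2 : IsClosed {y | Joined x y}ᶜ := key _ fun y z h h' h'' => h' (h''.trans h.symm)
  have h3 : {y | Joined x y} = Set.univ :=
    IsClopen.eq_univ ⟨h1, isClosed_compl_iff.1 h2⟩ ⟨x, Joined.refl x⟩
  have h4 : ∀ y, Joined x y := fun y => by
    have : y ∈ {y | Joined x y} := h3 ▸ trivial
    exact this
  exact ⟨⟨x⟩, fun y z => (h4 y).symm.trans (h4 z)⟩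

end CWComplex

/-! ### Mapping the complex to the model -/

section MapToModel

open Metric

/-- A map on the sphere that is homotopic to a constant map extends over the space by a map that
takes this constant value near the centre. -/
theorem exists_extension_of_homotopic_const {E Y : Type*} [NormedAddCommGroup E] [NormedSpace ℝ E]
    [TopologicalSpace Y] {u : C(sphere (0 : E) 1, Y)} {y₀ : Y}
    (h : u.Homotopic (ContinuousMap.const _ y₀)) :
    ∃ F : E → Y, Continuous F ∧ (∀ y : sphere (0 : E) 1, F y = u y) ∧ ∀ y, ‖y‖ ≤ 1 / 2 → F y = y₀ := by
  classical
  obtain ⟨H⟩ := h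
  have hmem : ∀ y : E, y ≠ 0 → ‖y‖⁻¹ • y ∈ sphere (0 : E) 1 := fun y hy => by
    rw [mem_sphere_zero_iff_norm, norm_smul, norm_inv, norm_norm,
      inv_mul_cancel₀ (norm_ne_zero_iff.2 hy)]
  -- The homotopy is run over the annulus `1/2 ≤ ‖y‖ ≤ 1`; the clamped time is `0` outside it and
  -- `1` inside.
  let F : E → Y := fun y => if hy : y ≠ 0 then
    H (Set.projIcc 0 1 zero_le_one (2 * (1 - ‖y‖)), ⟨‖y‖⁻¹ • y, hmem y hy⟩) else y₀
  have hF : ∀ y, ‖y‖ ≤ 1 / 2 → F y = y₀ := by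
    intro y hy
    by_cases h0 : y = 0
    · simp [F, h0]
    · simp only [F]
      rw [dif_pos h0, Set.projIcc_of_right_le _ (by linarith)]
      exact H.apply_one _
  refine ⟨F, ?_, fun y => ?_, hF⟩
  · rw [← continuousOn_univ]
    have hU : ({y : E | y ≠ 0} ∪ {y : E | ‖y‖ < 1 / 2}) = Set.univ := by
      refine Set.eq_univ_of_forall fun y => ?_
      by_cases h0 : y = 0
      · exact Or.inr (by simp [h0])
      · exact Or.inl h0
    rw [← hU]
    refine ContinuousOn.union_of_isOpen ?_ ?_ isOpen_ne (isOpen_lt continuous_norm continuous_const)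
    · rw [continuousOn_iff_continuous_domRestrict]
      have : Continuous fun y : {y : E | y ≠ 0} =>
          H (Set.projIcc 0 1 zero_le_one (2 * (1 - ‖(y : E)‖)), ⟨‖(y : E)‖⁻¹ • (y : E), hmem y y.2⟩) := by
        refine H.continuous.comp (Continuous.prodMk ?_ ?_)
        · exact continuous_projIcc.comp (by fun_prop)
        · refine Continuous.subtype_mk ?_ _
          exact (continuous_subtype_val.norm.inv₀ fun y => norm_ne_zero_iff.2 y.2).smul
            continuous_subtype_val
      convert this using 1
      ext ⟨y, hy⟩
      exact dif_pos hy
    · exact continuousOn_const.congr fun y hy => hF y (le_of_lt hy)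
  · have hy : ‖(y : E)‖ = 1 := mem_sphere_zero_iff_norm.1 y.2
    have h0 : (y : E) ≠ 0 := norm_ne_zero_iff.1 (by rw [hy]; exact one_ne_zero)
    simp only [F]
    rw [dif_pos h0]
    simp only [hy, sub_self, mul_zero, inv_one, one_smul, Set.projIcc_left]
    exact H.apply_zero _

variable {X : Type*} [TopologicalSpace X] [T2Space X] [CWComplex (Set.univ : Set X)]
  {Y : Type*} [TopologicalSpace Y]

/-- Over a single edge, a choice of paths at the end points extends to a map into the mapping path
space. -/
theorem exists_edge_extension {e : C(Y, X)} {y₀ : Y}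
    (he : ∀ q : Path (e y₀) (e y₀), ∃ p : Path y₀ y₀, (p.map e.continuous).Homotopic q)
    (α : ∀ x : X, Path x (e y₀)) (j : RelCWComplex.cell (Set.univ : Set X) 1) :
    ∃ F : (Fin 1 → ℝ) → Y × C(I, X), Continuous F ∧
      (∀ y ∈ sphere 0 1, F y = (y₀, (α (RelCWComplex.map 1 j y) : C(I, X)))) ∧
      ∀ y ∈ closedBall 0 1, (F y).2 0 = RelCWComplex.map 1 j y ∧ (F y).2 1 = e (F y).1 := by
  have hmem : ∀ t : I, (fun _ => 2 * (t : ℝ) - 1 : Fin 1 → ℝ) ∈ closedBall 0 1 := by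
    intro t
    rw [mem_closedBall_zero_iff, pi_norm_le_iff_of_nonneg zero_le_one]
    intro _
    rw [Real.norm_eq_abs, abs_le]
    constructor <;> linarith [t.2.1, t.2.2]
  let ε : Path (RelCWComplex.map 1 j fun _ => -1) (RelCWComplex.map 1 j fun _ => 1) :=
    { toFun := fun t => RelCWComplex.map 1 j fun _ => 2 * (t : ℝ) - 1
      continuous_toFun := (RelCWComplex.continuousOn 1 j).comp_continuous (by fun_prop) hmem
      source' := by simp
      target' := by norm_num }
  -- The edge, closed up by the chosen paths, is a loop at `e y₀`; `p` lifts it up to homotopy. The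
  -- filled square below supplies the homotopy from the edge to `e ∘ p`, with the prescribed paths
  -- over the ends.
  obtain ⟨p, hp⟩ := he ((α _).symm.trans (ε.trans (α _)))
  obtain ⟨K, hK0, hK1, hKα, hKβ⟩ := exists_square_of_homotopic
    (p := ε) (β := α _) (α := α _) (q := p.map e.continuous) (by
      rw [← pathClass_eq_iff] at hp ⊢
      rw [pathClass_trans, pathClass_trans, hp, pathClass_trans, pathClass_trans, pathClass_symm]
      simp)
  let τ : (Fin 1 → ℝ) → I := fun y => Set.projIcc 0 1 zero_le_one ((y 0 + 1) / 2)
  have hτ : Continuous τ := continuous_projIcc.comp (by fun_prop)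
  refine ⟨fun y => (p (τ y), K.curry (τ y)), by fun_prop, fun y hy => ?_, fun y hy => ?_⟩
  · have hy' : |y 0| = 1 := by
      rw [mem_sphere_zero_iff_norm] at hy
      rw [← hy, ← Real.norm_eq_abs, ← pi_norm_const (ι := Fin 1) (y 0)]
      congr 1
      ext i
      rw [Subsingleton.elim i 0]
    rcases (abs_eq zero_le_one).1 hy' with h | h
    · have e1 : y = fun _ => 1 := by ext i; rw [Subsingleton.elim i 0, h]
      have e2 : τ y = 1 := by simp [τ, h]
      dsimp only
      rw [e2, p.target, e1]
      refine Prod.ext rfl ?_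
      ext t
      exact hKβ t
    · have e1 : y = fun _ => -1 := by ext i; rw [Subsingleton.elim i 0, h]
      have e2 : τ y = 0 := by simp [τ, h]
      dsimp only
      rw [e2, p.source, e1]
      refine Prod.ext rfl ?_
      ext t
      exact hKα t
  · refine ⟨?_, hK1 (τ y)⟩
    refine (hK0 (τ y)).trans ?_
    change RelCWComplex.map 1 j (fun _ => 2 * (τ y : ℝ) - 1) = _
    congr 1
    ext i
    rw [mem_closedBall_zero_iff, pi_norm_le_iff_of_nonneg zero_le_one] at hy
    have := abs_le.1 (hy 0)
    rw [Subsingleton.elim i 0]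
    simp only [τ]
    rw [Set.projIcc_of_mem zero_le_one ⟨by linarith, by linarith⟩]
    simp only
    ring

/-- The inclusion of the `1`-skeleton lifts up to homotopy along a map that is surjective on
fundamental groups. -/
theorem exists_lift_oneSkeleton [PathConnectedSpace X] {e : C(Y, X)} {y₀ : Y}
    (he : ∀ q : Path (e y₀) (e y₀), ∃ p : Path y₀ y₀, (p.map e.continuous).Homotopic q) :
    ∃ f : X → Y, ContinuousOn f (RelCWComplex.skeletonLT (Set.univ : Set X) (2 : ℕ)) ∧
      HomotopicOn (RelCWComplex.skeletonLT (Set.univ : Set X) (2 : ℕ)) id (e ∘ f) := by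
  let α : ∀ x : X, Path x (e y₀) := fun x => (PathConnectedSpace.joined x (e y₀)).somePath
  choose F hF hFs hFb using exists_edge_extension he α
  -- The lift and the track of its homotopy are extended together, as one map to `Y × C(I, X)`.
  let f₀ : X → Y × C(I, X) := fun x => (y₀, (α x : C(I, X)))
  have hf₀ : ContinuousOn f₀ (RelCWComplex.skeletonLT (Set.univ : Set X) (0 + 1 : ℕ)) := by
    refine continuousOn_skeletonLT_succ ?_ fun j => ?_
    · rw [Nat.cast_zero, CWComplex.skeletonLT_zero_eq_empty]
      exact continuousOn_empty _
    · exact continuous_of_discreteTopology.continuousOn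
  obtain ⟨g, hg, hgF⟩ := exists_cell_extension f₀ F hFs
  have hgc : ContinuousOn g (RelCWComplex.skeletonLT (Set.univ : Set X) (1 + 1 : ℕ)) := by
    refine continuousOn_skeletonLT_succ (hf₀.congr hg) fun j => ?_
    exact (hF j).continuousOn.congr fun y hy => hgF j y hy
  refine ⟨fun x => (g x).1, continuous_fst.comp_continuousOn hgc, fun x => (g x).2,
    continuous_snd.comp_continuousOn hgc, fun x hx => ?_⟩
  obtain ⟨m, hm, j, y, hy, rfl⟩ := CWComplex.mem_skeletonLT_iff.1 hx
  have hm' : m < 2 := by exact_mod_cast hm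
  have hy' := ball_subset_closedBall hy
  change (g (RelCWComplex.map m j y)).2 0 = RelCWComplex.map m j y ∧
    (g (RelCWComplex.map m j y)).2 1 = e (g (RelCWComplex.map m j y)).1
  interval_cases m
  · rw [hg (map_mem_skeletonLT zero_lt_one j hy')]
    exact ⟨(α _).source, (α _).target⟩
  · rw [hgF j y hy']
    exact hFb j y hy'

/-- A lift on the `1`-skeleton extends over the `2`-cells if the map is injective on fundamental
groups. -/
theorem exists_extension_twoSkeleton [PathConnectedSpace Y] {e : C(Y, X)} {y₀ : Y}
    (he : ∀ p : Path y₀ y₀, pathClass (p.map e.continuous) = 𝟙 _ → pathClass p = 𝟙 _)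
    {f : X → Y} (hf : ContinuousOn f (RelCWComplex.skeletonLT (Set.univ : Set X) (2 : ℕ)))
    (hef : HomotopicOn (RelCWComplex.skeletonLT (Set.univ : Set X) (2 : ℕ)) id (e ∘ f)) :
    ∃ g : X → Y, ContinuousOn g (RelCWComplex.skeletonLT (Set.univ : Set X) (3 : ℕ)) ∧
      Set.EqOn g f (RelCWComplex.skeletonLT (Set.univ : Set X) (2 : ℕ)) ∧
      ∀ j : RelCWComplex.cell (Set.univ : Set X) 2, ∀ y, ‖y‖ ≤ 1 / 2 →
        g (RelCWComplex.map 2 j y) = y₀ := by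
  have key : ∀ j : RelCWComplex.cell (Set.univ : Set X) 2, ∃ F : (Fin 2 → ℝ) → Y, Continuous F ∧
      (∀ y ∈ sphere 0 1, F y = f (RelCWComplex.map 2 j y)) ∧ ∀ y, ‖y‖ ≤ 1 / 2 → F y = y₀ := by
    intro j
    have hmaps : Set.MapsTo (RelCWComplex.map 2 j) (sphere 0 1)
        (RelCWComplex.skeletonLT (Set.univ : Set X) (2 : ℕ)) :=
      fun y hy => map_mem_skeletonLT_of_sphere j hy
    have hmc := (RelCWComplex.continuousOn 2 j).mono sphere_subset_closedBall
    let u : C(sphere (0 : Fin 2 → ℝ) 1, Y) :=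
      ⟨(sphere 0 1).domRestrict (f ∘ RelCWComplex.map 2 j), (hf.comp hmc hmaps).domRestrict⟩
    -- The attaching map contracts through its own cell. On the sphere `e ∘ f` is homotopic to it,
    -- hence null-homotopic, and injectivity on loops passes this to `f`.
    have hnull : HomotopicOn (sphere 0 1) (RelCWComplex.map 2 j)
        fun _ => RelCWComplex.map 2 j 0 := by
      obtain ⟨K, hK, hKG⟩ := exists_curry_continuousOn (S := sphere (0 : Fin 2 → ℝ) 1)
        (G := fun y t => RelCWComplex.map 2 j ((1 - (t : ℝ)) • y)) (by
          refine (RelCWComplex.continuousOn 2 j).comp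
            (f := fun q : (Fin 2 → ℝ) × I => (1 - (q.2 : ℝ)) • q.1) (by fun_prop) ?_
          rintro ⟨y, t⟩ ⟨hy, -⟩
          rw [mem_closedBall_zero_iff, norm_smul, mem_sphere_zero_iff_norm.1 hy, mul_one,
            Real.norm_of_nonneg (by linarith [t.2.2])]
          linarith [t.2.1])
      exact ⟨K, hK, fun y hy => by rw [hKG y hy, hKG y hy]; simp⟩
    have hu : (e.comp u).Nullhomotopic :=
      ⟨_, ((hef.comp_right hmc hmaps).symm.trans hnull).homotopic⟩
    obtain ⟨F, hF, hFu, hF0⟩ :=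
      exists_extension_of_homotopic_const (homotopic_const_of_comp_nullhomotopic he hu)
    exact ⟨F, hF, fun y hy => hFu ⟨y, hy⟩, hF0⟩
  choose F hF hFs hF0 using key
  obtain ⟨g, hg, hgF⟩ := exists_cell_extension f F hFs
  refine ⟨g, continuousOn_skeletonLT_succ (n := 2) (hf.congr hg) fun j =>
    (hF j).continuousOn.congr fun y hy => hgF j y hy, hg, fun j y hy => ?_⟩
  rw [hgF j y (mem_closedBall_zero_iff.2 (hy.trans (by norm_num))), hF0 j y hy]

end MapToModel

/-! ### Radial geometry of the 2-cells and the categorical cover -/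

section TwoDimensional

open Metric

variable {X : Type*} [TopologicalSpace X] [CWComplex (Set.univ : Set X)]

theorem isEmpty_cell_of_cwDim_lt {n : ℕ} (h : cwDim (Set.univ : Set X) < n) :
    IsEmpty (RelCWComplex.cell (Set.univ : Set X) n) := by
  by_contra hne
  rw [not_isEmpty_iff] at hne
  exact not_le_of_gt h (le_iSup₂_of_le (f := fun (n : ℕ)
    (_ : Nonempty (RelCWComplex.cell (Set.univ : Set X) n)) => (n : ℕ∞)) n hne le_rfl)

variable [T2Space X]

theorem mem_skeletonLT_two_or_of_cwDim_le_two (hdim : cwDim (Set.univ : Set X) ≤ 2) (x : X) :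
    x ∈ (RelCWComplex.skeletonLT (Set.univ : Set X) (2 : ℕ) : Set X) ∨
      ∃ j : RelCWComplex.cell (Set.univ : Set X) 2, ∃ y ∈ closedBall 0 1,
        RelCWComplex.map 2 j y = x := by
  have hx : x ∈ (Set.univ : Set X) := trivial
  rw [← CWComplex.iUnion_openCell_eq_complex (C := (Set.univ : Set X))] at hx
  simp only [Set.mem_iUnion] at hx
  obtain ⟨n, j, y, hy, rfl⟩ := hx
  have hy' := ball_subset_closedBall hy
  rcases lt_trichotomy n 2 with h | rfl | h
  · exact Or.inl (map_mem_skeletonLT h j hy')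
  · exact Or.inr ⟨j, y, hy', rfl⟩
  · exact ((isEmpty_cell_of_cwDim_lt (hdim.trans_lt (by exact_mod_cast h))).false j).elim

theorem skeletonLT_three_eq_univ (hdim : cwDim (Set.univ : Set X) ≤ 2) :
    (RelCWComplex.skeletonLT (Set.univ : Set X) (3 : ℕ) : Set X) = Set.univ := by
  refine Set.eq_univ_of_forall fun x => ?_
  rcases mem_skeletonLT_two_or_of_cwDim_le_two hdim x with h | ⟨j, y, hy, rfl⟩
  · exact RelCWComplex.skeletonLT_mono (by norm_num) h
  · exact map_mem_skeletonLT (by norm_num) j hy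

/-- In a `2`-dimensional complex, continuity on an open set can be checked on the `1`-skeleton and
on the `2`-cells. -/
theorem continuousOn_of_cwDim_le_two (hdim : cwDim (Set.univ : Set X) ≤ 2) {Z : Type*}
    [TopologicalSpace Z] {P : Set X} (hP : IsOpen P) {f : X → Z}
    (h1 : ContinuousOn f (P ∩ RelCWComplex.skeletonLT (Set.univ : Set X) (2 : ℕ)))
    (h2 : ∀ j : RelCWComplex.cell (Set.univ : Set X) 2,
      ContinuousOn (f ∘ RelCWComplex.map 2 j) (closedBall 0 1 ∩ RelCWComplex.map 2 j ⁻¹' P)) :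
    ContinuousOn f P := by
  refine continuousOn_of_forall_comp_map hP fun n j => ?_
  rcases lt_trichotomy n 2 with h | rfl | h
  · exact h1.comp ((RelCWComplex.continuousOn n j).mono Set.inter_subset_left)
      fun y hy => ⟨hy.2, map_mem_skeletonLT h j hy.1⟩
  · exact h2 j
  · exact ((isEmpty_cell_of_cwDim_lt (hdim.trans_lt (by exact_mod_cast h))).false j).elim

/-- The radius function of a `2`-dimensional complex, which is `1` on the `1`-skeleton. -/
theorem exists_radius (hdim : cwDim (Set.univ : Set X) ≤ 2) :
    ∃ ρ : X → ℝ, Continuous ρ ∧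
      (∀ x ∈ (RelCWComplex.skeletonLT (Set.univ : Set X) (2 : ℕ) : Set X), ρ x = 1) ∧
      ∀ j : RelCWComplex.cell (Set.univ : Set X) 2, ∀ y ∈ closedBall 0 1,
        ρ (RelCWComplex.map 2 j y) = ‖y‖ := by
  obtain ⟨ρ, h1, h2⟩ := exists_cell_extension (X := X) (n := 2) (fun _ => (1 : ℝ)) (fun _ y => ‖y‖)
    fun j y hy => mem_sphere_zero_iff_norm.1 hy
  refine ⟨ρ, ?_, h1, h2⟩
  rw [← continuousOn_univ, ← skeletonLT_three_eq_univ hdim]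
  exact continuousOn_skeletonLT_succ (n := 2) (continuousOn_const.congr h1) fun j =>
    continuous_norm.continuousOn.congr fun y hy => h2 j y hy

/-- The complement of the centres of the `2`-cells deforms radially into the `1`-skeleton. -/
theorem exists_radial_deformation (hdim : cwDim (Set.univ : Set X) ≤ 2) {ρ : X → ℝ}
    (hρ : Continuous ρ) (hρ2 : ∀ j : RelCWComplex.cell (Set.univ : Set X) 2, ∀ y ∈ closedBall 0 1,
      ρ (RelCWComplex.map 2 j y) = ‖y‖) :
    ∃ K : X → C(I, X), ContinuousOn K {x | 0 < ρ x} ∧ (∀ x, 0 < ρ x → K x 0 = x) ∧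
      ∀ x, 0 < ρ x → K x 1 ∈ (RelCWComplex.skeletonLT (Set.univ : Set X) (2 : ℕ) : Set X) := by
  -- The straight-line homotopy from `y` to `‖y‖⁻¹ • y`, constant on the sphere and thus compatible
  -- with constant tracks on the 1-skeleton.
  have key : ∀ j : RelCWComplex.cell (Set.univ : Set X) 2, ∃ K : (Fin 2 → ℝ) → C(I, X),
      ContinuousOn K {y | y ∈ closedBall 0 1 ∧ y ≠ 0} ∧
      ∀ y ∈ {y : Fin 2 → ℝ | y ∈ closedBall 0 1 ∧ y ≠ 0}, ∀ t : I,
        K y t = RelCWComplex.map 2 j ((1 - (t : ℝ) + t * ‖y‖⁻¹) • y) := by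
    intro j
    refine exists_curry_continuousOn ((RelCWComplex.continuousOn 2 j).comp
      (f := fun q : (Fin 2 → ℝ) × I => (1 - (q.2 : ℝ) + q.2 * ‖q.1‖⁻¹) • q.1) ?_ ?_)
    · have h : ContinuousOn (fun q : (Fin 2 → ℝ) × I => ‖q.1‖⁻¹)
          ({y | y ∈ closedBall 0 1 ∧ y ≠ 0} ×ˢ Set.univ) :=
        ContinuousOn.inv₀ (by fun_prop) fun q hq => norm_ne_zero_iff.2 hq.1.2
      fun_prop
    · rintro ⟨y, t⟩ ⟨⟨hy, hy0⟩, -⟩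
      have hpos : 0 < ‖y‖ := norm_pos_iff.2 hy0
      have ht := t.2.1
      have ht' := t.2.2
      rw [mem_closedBall_zero_iff] at hy ⊢
      rw [norm_smul, Real.norm_of_nonneg (by have := mul_nonneg ht (inv_nonneg.2 hpos.le); linarith),
        add_mul, mul_assoc, inv_mul_cancel₀ hpos.ne']
      nlinarith
  choose F hFc hF using key
  have hnz : ∀ y : Fin 2 → ℝ, y ∈ sphere 0 1 → y ∈ closedBall 0 1 ∧ y ≠ 0 := by
    intro y hy
    refine ⟨sphere_subset_closedBall hy, ?_⟩
    rintro rfl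
    simp at hy
  obtain ⟨K, hK1, hK2⟩ := exists_cell_extension (X := X) (n := 2)
    (fun x => ContinuousMap.const I x) F (by
      intro j y hy
      ext t
      rw [hF j y (hnz y hy), mem_sphere_zero_iff_norm.1 hy]
      simp)
  have hpos : ∀ (j : RelCWComplex.cell (Set.univ : Set X) 2) (y : Fin 2 → ℝ),
      y ∈ closedBall 0 1 → 0 < ρ (RelCWComplex.map 2 j y) → y ∈ closedBall 0 1 ∧ y ≠ 0 := by
    intro j y hy h
    rw [hρ2 j y hy] at h
    exact ⟨hy, norm_pos_iff.1 h⟩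
  refine ⟨K, ?_, fun x hx => ?_, fun x hx => ?_⟩
  · refine continuousOn_of_cwDim_le_two hdim (isOpen_lt continuous_const hρ) ?_ fun j => ?_
    · exact ContinuousOn.congr (ContinuousMap.continuous_const').continuousOn fun x hx => hK1 hx.2
    · refine ContinuousOn.congr ((hFc j).mono fun y hy => hpos j y hy.1 hy.2) fun y hy => ?_
      exact hK2 j y hy.1
  · rcases mem_skeletonLT_two_or_of_cwDim_le_two hdim x with h | ⟨j, y, hy, rfl⟩
    · rw [hK1 h]; rfl
    · rw [hK2 j y hy, hF j y (hpos j y hy hx)]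
      simp
  · rcases mem_skeletonLT_two_or_of_cwDim_le_two hdim x with h | ⟨j, y, hy, rfl⟩
    · rw [hK1 h]; exact h
    · rw [hK2 j y hy, hF j y (hpos j y hy hx)]
      refine map_mem_skeletonLT_of_sphere j ?_
      have h0 := norm_ne_zero_iff.2 (hpos j y hy hx).2
      rw [mem_sphere_zero_iff_norm]
      simp [norm_smul, h0]

/-- Functions on the open `2`-cells assemble to a continuous function on any open set that does not
meet the `1`-skeleton. -/
theorem exists_continuousOn_of_disjoint_skeletonLT (hdim : cwDim (Set.univ : Set X) ≤ 2)
    {Z : Type*} [TopologicalSpace Z] [Nonempty Z] {V : Set X} (hV : IsOpen V)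
    (hVs : Disjoint V (RelCWComplex.skeletonLT (Set.univ : Set X) (2 : ℕ)))
    (G : RelCWComplex.cell (Set.univ : Set X) 2 → (Fin 2 → ℝ) → Z)
    (hG : ∀ j, ContinuousOn (G j) (closedBall 0 1)) :
    ∃ g : X → Z, ContinuousOn g V ∧ ∀ j, ∀ y ∈ closedBall 0 1, RelCWComplex.map 2 j y ∈ V →
      g (RelCWComplex.map 2 j y) = G j y := by
  classical
  obtain ⟨z⟩ := (inferInstance : Nonempty Z)
  -- The boundary value `z` is arbitrary: `V` misses the 1-skeleton and never sees it.
  obtain ⟨g, -, hg⟩ := exists_cell_extension (X := X) (n := 2) (fun _ => z)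
    (fun j y => if y ∈ sphere 0 1 then z else G j y) fun j y hy => if_pos hy
  have hgG : ∀ j, ∀ y ∈ closedBall 0 1, RelCWComplex.map 2 j y ∈ V →
      g (RelCWComplex.map 2 j y) = G j y := by
    intro j y hy hyV
    rw [hg j y hy]
    exact if_neg fun h => Set.disjoint_left.1 hVs hyV (map_mem_skeletonLT_of_sphere j h)
  refine ⟨g, continuousOn_of_cwDim_le_two hdim hV ?_ fun j => ?_, hgG⟩
  · rw [hVs.inter_eq]
    exact continuousOn_empty _
  · exact ((hG j).mono Set.inter_subset_left).congr fun y hy => hgG j y hy.1 hy.2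

/-- An open set that does not meet the `1`-skeleton is contractible in a path-connected
`2`-dimensional complex. -/
theorem homotopicOn_const_of_disjoint_skeletonLT [PathConnectedSpace X]
    (hdim : cwDim (Set.univ : Set X) ≤ 2) {V : Set X} (hV : IsOpen V)
    (hVs : Disjoint V (RelCWComplex.skeletonLT (Set.univ : Set X) (2 : ℕ))) (x₀ : X) :
    HomotopicOn V id fun _ => x₀ := by
  have key : ∀ j : RelCWComplex.cell (Set.univ : Set X) 2, ∃ K : (Fin 2 → ℝ) → C(I, X),
      ContinuousOn K (closedBall 0 1) ∧ ∀ y ∈ closedBall (0 : Fin 2 → ℝ) 1, ∀ t : I,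
        K y t = RelCWComplex.map 2 j ((1 - (t : ℝ)) • y) := by
    intro j
    refine exists_curry_continuousOn ((RelCWComplex.continuousOn 2 j).comp
      (f := fun q : (Fin 2 → ℝ) × I => (1 - (q.2 : ℝ)) • q.1) (by fun_prop) ?_)
    rintro ⟨y, t⟩ ⟨hy, -⟩
    have ht := t.2.1
    rw [mem_closedBall_zero_iff] at hy ⊢
    rw [norm_smul, Real.norm_of_nonneg (by linarith [t.2.2])]
    nlinarith [norm_nonneg y]
  choose F hFc hF using key
  -- Each cell is contracted to its centre, which is then carried to `x₀`. The paths may be chosen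
  -- independently, since within `V` distinct cells do not touch.
  let δ : ∀ j : RelCWComplex.cell (Set.univ : Set X) 2, Path (RelCWComplex.map 2 j 0) x₀ :=
    fun j => (PathConnectedSpace.joined _ _).somePath
  have : Nonempty C(I, X) := ⟨ContinuousMap.const I x₀⟩
  obtain ⟨K, hK, hKF⟩ := exists_continuousOn_of_disjoint_skeletonLT hdim hV hVs F hFc
  obtain ⟨L, hL, hLδ⟩ := exists_continuousOn_of_disjoint_skeletonLT hdim hV hVs
    (fun j _ => (δ j : C(I, X))) fun j => continuousOn_const
  have hcell : ∀ x ∈ V, ∃ j : RelCWComplex.cell (Set.univ : Set X) 2, ∃ y ∈ closedBall 0 1,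
      RelCWComplex.map 2 j y = x := fun x hx =>
    (mem_skeletonLT_two_or_of_cwDim_le_two hdim x).resolve_left (Set.disjoint_left.1 hVs hx)
  have h1 : HomotopicOn V id fun x => L x 0 := by
    refine ⟨K, hK, fun x hx => ?_⟩
    obtain ⟨j, y, hy, rfl⟩ := hcell x hx
    dsimp only
    rw [hKF j y hy hx, hF j y hy, hF j y hy, hLδ j y hy hx]
    simp
  have h2 : HomotopicOn V (fun x => L x 0) fun _ => x₀ := by
    refine ⟨L, hL, fun x hx => ⟨rfl, ?_⟩⟩
    obtain ⟨j, y, hy, rfl⟩ := hcell x hx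
    rw [hLδ j y hy hx]
    exact (δ j).target
  exact h1.trans h2

/-- A `2`-dimensional complex with free fundamental group is covered by two open sets that are
contractible in it. -/
theorem hasCategoricalCover_one_of_isFreeGroup [ConnectedSpace X]
    (hdim : cwDim (Set.univ : Set X) ≤ 2) (x₀ : X) (hfree : IsFreeGroup (FundamentalGroup X x₀)) :
    HasCategoricalCover X 1 := by
  have := CWComplex.pathConnectedSpace (X := X)
  obtain ⟨Y, _, _, e, y₀, W₀, W₁, hW₀, hW₁, hW, hy₀, hc₀, hc₁, hsurj, hinj⟩ :=
    exists_map_bijective_on_loops x₀ hfree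
  obtain ⟨f, hf, hef⟩ := exists_lift_oneSkeleton hsurj
  obtain ⟨g, hg, hgf, hg0⟩ := exists_extension_twoSkeleton hinj hf hef
  rw [skeletonLT_three_eq_univ hdim, continuousOn_univ] at hg
  obtain ⟨ρ, hρ, hρ1, hρ2⟩ := exists_radius hdim
  obtain ⟨K, hK, hK0, hK1⟩ := exists_radial_deformation hdim hρ hρ2
  have hr : HomotopicOn {x | 0 < ρ x} id fun x => K x 1 :=
    ⟨K, hK, fun x hx => ⟨hK0 x hx, rfl⟩⟩
  -- With `r x = K x 1`, the chain is `id ≃ r ≃ e ∘ f ∘ r = e ∘ g ∘ r ≃ e ∘ g`.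
  have hidg : HomotopicOn {x | 0 < ρ x} id (e ∘ g) := by
    have h1 : HomotopicOn {x | 0 < ρ x} (fun x => K x 1) (e ∘ f ∘ fun x => K x 1) :=
      hef.comp_right hr.continuousOn_right fun x hx => hK1 x hx
    have h2 : HomotopicOn {x | 0 < ρ x} (e ∘ g) (e ∘ f ∘ fun x => K x 1) :=
      (hr.comp_left ((e.comp ⟨g, hg⟩))).congr (fun _ _ => rfl) fun x hx =>
        congr_arg e (hgf (hK1 x hx)).symm
    exact (hr.trans h1).trans h2.symm
  have hpull : ∀ {W : Set Y} {P : Set X}, HomotopicOn W id (fun _ => y₀) → P ⊆ {x | 0 < ρ x} →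
      HomotopicOn (g ⁻¹' W ∩ P) id fun _ => e y₀ := by
    intro W P hWc hP
    refine (hidg.mono (Set.inter_subset_right.trans hP)).trans ?_
    exact (hWc.comp_right hg.continuousOn fun x hx => hx.1).comp_left e
  have hopen : ∀ r, IsOpen {x | r < ρ x} := fun r => isOpen_lt continuous_const hρ
  have hB : IsOpen {x | ρ x < 1 / 2} := isOpen_lt hρ continuous_const
  have h0 : HomotopicOn (g ⁻¹' W₀ ∩ {x | 0 < ρ x}) id fun _ => e y₀ := hpull hc₀ subset_rfl
  have h1 : HomotopicOn ((g ⁻¹' W₁ ∩ {x | 1 / 2 < ρ x}) ∪ {x | ρ x < 1 / 2}) id fun _ => e y₀ := by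
    refine (hpull hc₁ ?_).union_of_disjoint
      (homotopicOn_const_of_disjoint_skeletonLT hdim hB ?_ _)
      ((hW₁.preimage hg).inter (hopen _)) hB ?_
    · intro x hx
      exact one_half_pos.trans (show 1 / 2 < ρ x from hx)
    · refine Set.disjoint_left.2 fun x hx hx' => ?_
      rw [Set.mem_ofPred_eq, hρ1 x hx'] at hx
      norm_num at hx
    · exact Set.disjoint_left.2 fun x hx (hx' : ρ x < 1 / 2) =>
        lt_asymm (show 1 / 2 < ρ x from hx.2) hx'
  refine ⟨![g ⁻¹' W₀ ∩ {x | 0 < ρ x}, (g ⁻¹' W₁ ∩ {x | 1 / 2 < ρ x}) ∪ {x | ρ x < 1 / 2}],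
    Fin.forall_fin_two.2 ⟨(hW₀.preimage hg).inter (hopen _),
      ((hW₁.preimage hg).inter (hopen _)).union hB⟩,
    Fin.forall_fin_two.2 ⟨h0.contractibleIn, h1.contractibleIn⟩,
    Set.eq_univ_of_forall fun x => Set.mem_iUnion.2 (Fin.exists_fin_two.2 ?_)⟩
  rcases lt_or_ge (ρ x) (1 / 2) with hx | hx
  · exact Or.inr (Or.inr hx)
  rcases hx.eq_or_lt with hx | hx
  -- Radius exactly `1/2` is missed by both pieces of the second set; there `g` takes the value `y₀
  -- ∈ W₀`.
  · refine Or.inl ⟨?_, one_half_pos.trans_eq hx⟩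
    rcases mem_skeletonLT_two_or_of_cwDim_le_two hdim x with h | ⟨j, y, hy, rfl⟩
    · rw [hρ1 x h] at hx
      norm_num at hx
    · rw [hρ2 j y hy] at hx
      rw [Set.mem_preimage, hg0 j y hx.ge]
      exact hy₀
  · have hgx : g x ∈ W₀ ∪ W₁ := hW ▸ trivial
    rcases hgx with h | h
    · exact Or.inl ⟨h, one_half_pos.trans hx⟩
    · exact Or.inr (Or.inl ⟨h, hx⟩)

end TwoDimensional

theorem propositionp {X : Type*} [TopologicalSpace X] [T2Space X]
    [Topology.CWComplex (Set.univ : Set X)] [ConnectedSpace X]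
    (hdim : cwDim (Set.univ : Set X) = 2)
    (x₀ : X) (hfree : IsFreeGroup (FundamentalGroup X x₀)) :
    lsCat X ≤ 1 :=
  sInf_le ⟨1, rfl, hasCategoricalCover_one_of_isFreeGroup hdim.le x₀ hfree⟩
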